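/- **Setting.** Let $X_k=\{X_k(n):n\ge 1\}$, $k\in[K]=\{1,\dots,K\}$, be independent data streams. Stream $k$ has law $\mathrm P_k^1$ if it is a signal and $\mathrm P_k^0$ if it is noise. For $A\subseteq[K]$ let $\mathrm P_A$ (with expectation $\mathrm E_A$) be the product law of $(X_1,\dots,X_K)$ when $A$ is the set of signals. Let $\mathcal F_k(n)=\sigma(X_k(1),\dots,X_k(n))$ and $\mathcal F(n)=\sigma(\mathcal F_1(n),\dots,\mathcal F_K(n))$. Assume that $\mathrm P_k^1$ and $\mathrm P_k^0$ are mutually absolutely continuous on each $\mathcal F_k(n)$, $n\ge1$, and let $\lambda_k(n)=\log\frac{d\mathrm P_k^1}{d\mathrm P_k^0}(\mathcal F_k(n))$. Assume that there are numbers $I_k,J_k>0$ such that, for every $k\in[K]$, $$\mathrm P_k^1\Big(\limsup_{n}\tfrac{\lambda_k(n)}n\le I_k\Big)=1,\qquad \mathrm P_k^0\Big(\limsup_{n}\tfrac{-\lambda_k(n)}n\le J_k\Big)=1,$$ and, for every $\epsilon>0$, $$\sum_{n\ge1}\mathrm P_k^1\Big(\tfrac{\lambda_k(n)}n\le I_k-\epsilon\Big)<\infty,\qquad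 \sum_{n\ge1}\mathrm P_k^0\Big(\tfrac{-\lambda_k(n)}n\le J_k-\epsilon\Big)<\infty .$$ **Procedures.** Let $0\le l\le u\le K$ with $u>0$, $l<K$, and let $\Pi_{l,u}=\{A\subseteq[K]:l\le|A|\le u\}$. A sequential multiple testing procedure consists of random times $T_k\in\{1,2,\dots\}\cup\{\infty\}$ and a random set $\mathbf D\subseteq[K]$ of streams identified as signals, such that, for all $k\in[K]$ and $n\ge1$, the events $\{T_k=n\}$, $\{T_k=n,\,k\in\mathbf D\}$ and $\{T_k=n,\,k\notin\mathbf D\}$ belong to $\mathcal F(n)$. It is synchronous if $T_1=\dots=T_K$. For $\alpha,\beta\in(0,1)$, $\Delta(\alpha,\beta,\Pi_{l,u})$ is the set of the procedures with $\mathrm P_A(T_k<\infty)=1$ for all $k\in[K]$, $\mathrm P_A(\mathbf D\setminus A\ne\emptyset)\le\alpha$ and $\mathrm P_A(A\setminus\mathbf D\neq\emptyset)\le\beta$ for every $A\in\Pi_{l,u}$. For $A\in\Pi_{l,u}$, let $\mathcal L''_A(\alpha,\beta,\Pi_{l,u})$ be the infimum of $\mathrm E_A[T_1]$ over all synchronous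 procedures in $\Delta(\alpha,\beta,\Pi_{l,u})$. **The procedure $\check\chi=(\check T,\check{\mathbf D})$.** Let $\lambda_{(1)}(n)\ge\dots\ge\lambda_{(K)}(n)$ be the ordered values of $\lambda_1(n),\dots,\lambda_K(n)$, put $\lambda_{(0)}(n)=+\infty$ and $\lambda_{(K+1)}(n)=-\infty$, and let $p(n)=|\{k:\lambda_k(n)>0\}|$. Let $a,b,c,d>0$ be thresholds; infima are over $n\ge1$, and $\inf\emptyset=\infty$. If $l=u$, then $$\check T=\inf\{n:\lambda_{(l)}(n)-\lambda_{(l+1)}(n)\ge\max(c,d)\}.$$ If $l<u$, then $\check T=\min\{\tau_1,\tau_2,\tau_3\}$, where $$\begin{aligned}\tau_1&=\inf\{n:\lambda_{(l+1)}(n)\le\min\{-b,\,-c+\lambda_{(l)}(n)\}\},\\ \tau_2&=\inf\{n:\lambda_k(n)\notin(-b,a)\ \text{for all } k\in[K],\ \text{and } l\le p(n)\le u\},\\ \tau_3&=\inf\{n:\lambda_{(u)}(n)\ge\max\{a,\,d+\lambda_{(u+1)}(n)\}\}.\end{aligned}$$ In both cases $\check{\mathbf D}$ is the set of the $\min\{\max\{p(\check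 T),l\},u\}$ streams with the largest $\lambda_k(\check T)$. **Theorem 4.3.** Suppose that the thresholds $a,b,c,d>0$ are functions of $(\alpha,\beta)$ such that $\check\chi\in\Delta(\alpha,\beta,\Pi_{l,u})$ for all $\alpha,\beta\in(0,1)$ and such that $a,c\sim|\log\alpha|$ and $b,d\sim|\log\beta|$ as $\alpha,\beta\to0$. Put $\mathcal I_A=\min_{i\in A}I_i$ and $\mathcal J_A=\min_{j\notin A}J_j$, where $\min\emptyset=\infty$, $x/\infty=0$ for real $x$, and $\infty\cdot 0=0$. Then, for every $A\in\Pi_{l,u}$, as $\alpha,\beta\to0$ (jointly, in any manner), $$\mathrm E_A[\check T]\;\sim\;\mathcal L''_A(\alpha,\beta,\Pi_{l,u})\;\sim\;\max\left\{\frac{|\log\alpha|}{\mathcal I_A+\mathcal J_A\,\mathbf 1\{|A|=l\}},\ \frac{|\log\beta|}{\mathcal J_A+\mathcal I_A\,\mathbf 1\{|A|=u\}}\right\},$$ where $f\sim g$ means that $f/g\to1$. -/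

import Mathlib

open MeasureTheory Filter
open scoped Topology ENNReal

namespace SeqMT

/-! Data streams are modelled on the canonical space.  The sequence of observations of stream `k`
is a point `x : ℕ → E k`, with `x t` the observation collected at time `t + 1`, so that the first
`n` observations are the coordinates `t < n`. -/

section Stream

variable {E : Type*} [MeasurableSpace E]

/-- The σ-algebra generated by the first `n` observations of a single stream. -/
abbrev streamSigma (E : Type*) [MeasurableSpace E] (n : ℕ) : MeasurableSpace (ℕ → E) :=
  ⨆ t ∈ Finset.range n, MeasurableSpace.comap (fun x : ℕ → E => x t) inferInstance

theorem streamSigma_le (n : ℕ) : streamSigma E n ≤ MeasurableSpace.pi :=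
  iSup₂_le fun t _ => (measurable_pi_apply t).comap_le

theorem streamSigma_mono {m n : ℕ} (h : m ≤ n) : streamSigma E m ≤ streamSigma E n :=
  iSup₂_le fun t ht =>
    le_iSup₂_of_le t (Finset.mem_range.2 (lt_of_lt_of_le (Finset.mem_range.1 ht) h)) le_rfl

/-- The restriction of a law `μ` of a stream to the σ-algebra of its first `n` observations. -/
noncomputable def restrictLaw (μ : Measure (ℕ → E)) (n : ℕ) :
    @Measure (ℕ → E) (streamSigma E n) :=
  μ.trim (streamSigma_le n)

/-- The two laws are mutually absolutely continuous on the first `n` observations, for all `n`. -/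
def LocallyEquivalent (μ₁ μ₀ : Measure (ℕ → E)) : Prop :=
  ∀ n : ℕ, 1 ≤ n →
    (restrictLaw μ₁ n).AbsolutelyContinuous (restrictLaw μ₀ n) ∧
      (restrictLaw μ₀ n).AbsolutelyContinuous (restrictLaw μ₁ n)

/-- The log-likelihood ratio `log (dμ₁/dμ₀)` of the first `n` observations. -/
noncomputable def streamLLR (μ₁ μ₀ : Measure (ℕ → E)) (n : ℕ) : (ℕ → E) → ℝ :=
  @llr _ (streamSigma E n) (restrictLaw μ₁ n) (restrictLaw μ₀ n)

/-- `limsup ξ(n)/n ≤ r` almost surely under `μ`; the limsup is taken in the extended reals. -/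
def LimsupRateLE (μ : Measure (ℕ → E)) (ξ : ℕ → (ℕ → E) → ℝ) (r : ℝ) : Prop :=
  ∀ᵐ x ∂μ, limsup (fun n : ℕ => ((ξ n x / n : ℝ) : EReal)) atTop ≤ (r : EReal)

/-- `∑_{n ≥ 1} μ(ξ(n)/n ≤ r - ε) < ∞` for every `ε > 0`. -/
def CompleteLowerRate (μ : Measure (ℕ → E)) (ξ : ℕ → (ℕ → E) → ℝ) (r : ℝ) : Prop :=
  ∀ ε : ℝ, 0 < ε →
    ∑' n : ℕ, μ {x | ξ (n + 1) x / ((n + 1 : ℕ) : ℝ) ≤ r - ε} < ⊤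

end Stream

section Procedures

variable {K : ℕ} {E : Fin K → Type*} [∀ k, MeasurableSpace (E k)]

/-- The observations of all the streams. -/
abbrev Obs (E : Fin K → Type*) : Type _ := ∀ k, ℕ → E k

/-- The filtration generated by the observations of all the streams. -/
def obsFiltration (E : Fin K → Type*) [∀ k, MeasurableSpace (E k)] :
    Filtration ℕ (MeasurableSpace.pi : MeasurableSpace (Obs E)) where
  seq n := ⨆ k, MeasurableSpace.comap (fun ω : Obs E => ω k) (streamSigma (E k) n)
  mono' _ _ h := iSup_mono fun _ => MeasurableSpace.comap_mono (streamSigma_mono h)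
  le' n := iSup_le fun k =>
    (MeasurableSpace.comap_mono (streamSigma_le n)).trans (measurable_pi_apply k).comap_le

/-- The joint law when `A` is the set of signals: the streams are independent, stream `k` has
law `P₁ k` if `k ∈ A` and `P₀ k` otherwise. -/
noncomputable def jointLaw (P₀ P₁ : ∀ k, Measure (ℕ → E k)) (A : Finset (Fin K)) :
    Measure (Obs E) :=
  Measure.pi fun k => if k ∈ A then P₁ k else P₀ k

/-- The class of all sets of signals whose size is between `l` and `u`. -/
def signalClass (K l u : ℕ) : Set (Finset (Fin K)) :=
  {A | l ≤ A.card ∧ A.card ≤ u}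

/-- Decision times `T k` (with value `⊤` if no decision is made in stream `k`) together with the
set `D` of streams that are identified as signals. -/
structure DecisionRule (E : Fin K → Type*) where
  T : Fin K → Obs E → ℕ∞
  D : Obs E → Finset (Fin K)

/-- Sequential multiple testing procedures: each `T k ≥ 1` is a stopping time, and
`{T k = n, D k = i}` belongs to the σ-algebra of the observations up to time `n`. -/
def DecisionRule.IsSequentialTest (χ : DecisionRule E) : Prop :=
  ∀ k, IsStoppingTime (obsFiltration E) (χ.T k) ∧ (∀ ω, 1 ≤ χ.T k ω) ∧
    ∀ n : ℕ, 1 ≤ n →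
      MeasurableSet[obsFiltration E n] {ω | χ.T k ω = n ∧ k ∈ χ.D ω} ∧
      MeasurableSet[obsFiltration E n] {ω | χ.T k ω = n ∧ k ∉ χ.D ω}

/-- All decisions are made at the same time. -/
def DecisionRule.IsSynchronous (χ : DecisionRule E) : Prop :=
  ∀ j k, χ.T j = χ.T k

/-- Type-I familywise error rate: the probability that some noise is identified as a signal. -/
noncomputable def DecisionRule.fwe1 (χ : DecisionRule E) (P₀ P₁ : ∀ k, Measure (ℕ → E k))
    (A : Finset (Fin K)) : ℝ≥0∞ :=
  jointLaw P₀ P₁ A {ω | ∃ j, j ∉ A ∧ j ∈ χ.D ω}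

/-- Type-II familywise error rate: the probability that some signal is identified as noise. -/
noncomputable def DecisionRule.fwe2 (χ : DecisionRule E) (P₀ P₁ : ∀ k, Measure (ℕ → E k))
    (A : Finset (Fin K)) : ℝ≥0∞ :=
  jointLaw P₀ P₁ A {ω | ∃ i, i ∈ A ∧ i ∉ χ.D ω}

/-- Procedures that, for every set of signals in the class `C`, terminate almost surely in every
stream and have familywise error rates of type I and II at most `α` and `β`. -/
def ControlledTests (P₀ P₁ : ∀ k, Measure (ℕ → E k)) (α β : ℝ) (C : Set (Finset (Fin K))) :
    Set (DecisionRule E) :=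
  {χ | χ.IsSequentialTest ∧ ∀ A ∈ C,
    (∀ k, ∀ᵐ ω ∂(jointLaw P₀ P₁ A), χ.T k ω < ⊤) ∧
    χ.fwe1 P₀ P₁ A ≤ ENNReal.ofReal α ∧ χ.fwe2 P₀ P₁ A ≤ ENNReal.ofReal β}

/-- The expected decision time in stream `k` when the set of signals is `A`. -/
noncomputable def DecisionRule.expectedTime (χ : DecisionRule E)
    (P₀ P₁ : ∀ k, Measure (ℕ → E k)) (A : Finset (Fin K)) (k : Fin K) : ℝ≥0∞ :=
  ∫⁻ ω, (χ.T k ω : ℝ≥0∞) ∂(jointLaw P₀ P₁ A)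

/-- The optimal expected decision time among the synchronous procedures in
`ControlledTests P₀ P₁ α β C` when the set of signals is `A`.  The decision time is read off in
stream `k`; for synchronous procedures it is the same in all streams. -/
noncomputable def optimalSyncTime (P₀ P₁ : ∀ k, Measure (ℕ → E k)) (α β : ℝ)
    (C : Set (Finset (Fin K))) (A : Finset (Fin K)) (k : Fin K) : ℝ≥0∞ :=
  ⨅ χ ∈ {χ : DecisionRule E | χ.IsSynchronous} ∩ ControlledTests P₀ P₁ α β C,
    χ.expectedTime P₀ P₁ A k

/-- The log-likelihood ratio of stream `k` at time `n`, as a function of all the observations. -/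
noncomputable def obsLLR (P₀ P₁ : ∀ k, Measure (ℕ → E k)) (n : ℕ) (ω : Obs E) (k : Fin K) : ℝ :=
  streamLLR (P₁ k) (P₀ k) n (ω k)

end Procedures

section Synchronous

variable {K : ℕ}

/-- The `r`-th largest of the numbers `x k`, for `1 ≤ r ≤ K`: the largest level `t` that is
reached by at least `r` of them.  It is `+∞` for `r = 0` and `-∞` for `r > K`. -/
noncomputable def orderStat (x : Fin K → ℝ) (r : ℕ) : EReal :=
  sSup {t : EReal | r ≤ (Finset.univ.filter fun k => t ≤ (x k : EReal)).card}

/-- The number of positive coordinates. -/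
noncomputable def numPos (x : Fin K → ℝ) : ℕ :=
  (Finset.univ.filter fun k => 0 < x k).card

/-- The `s` streams with the largest values; ties are broken in favour of the smaller index. -/
noncomputable def topStreams (x : Fin K → ℝ) (s : ℕ) : Finset (Fin K) :=
  Finset.univ.filter fun k =>
    (Finset.univ.filter fun j => x k < x j ∨ (x j = x k ∧ j < k)).card < s

/-- The first time `n ≥ 1` at which `p` holds, and `⊤` if there is none. -/
noncomputable def firstTime (p : ℕ → Prop) : ℕ∞ :=
  ⨅ n ∈ {n : ℕ | 1 ≤ n ∧ p n}, (n : ℕ∞)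

/-- The stopping time of the gap rule (`l = u`) and of the gap-intersection rule (`l ≠ u`) along
a trajectory `x` of the vector of log-likelihood ratios. -/
noncomputable def syncTime (l u : ℕ) (a b c d : ℝ) (x : ℕ → Fin K → ℝ) : ℕ∞ :=
  if l = u then
    firstTime fun n => ((max c d : ℝ) : EReal) ≤ orderStat (x n) l - orderStat (x n) (l + 1)
  else
    min (firstTime fun n =>
        orderStat (x n) (l + 1) ≤ min (-b : EReal) (-c + orderStat (x n) l))
      (min
        (firstTime fun n =>
          (∀ k, x n k ∉ Set.Ioo (-b) a) ∧ l ≤ numPos (x n) ∧ numPos (x n) ≤ u)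
        (firstTime fun n =>
          max (a : EReal) (d + orderStat (x n) (u + 1)) ≤ orderStat (x n) u))

/-- The streams identified as signals at the stopping time: those with the `(p ∨ l) ∧ u` largest
log-likelihood ratios, where `p` is the number of positive ones (so there are `l` of them if
`l = u`).  The value is immaterial if the stopping time is infinite. -/
noncomputable def syncDecision (l u : ℕ) (a b c d : ℝ) (x : ℕ → Fin K → ℝ) : Finset (Fin K) :=
  if syncTime l u a b c d x = ⊤ then ∅
  else
    let y := x (syncTime l u a b c d x).toNat
    topStreams y (min (max (numPos y) l) u)

/-- The synchronous procedure with thresholds `a, b, c, d`: the gap rule if `l = u`, and the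
gap-intersection rule if `l < u`. -/
noncomputable def syncTest {E : Fin K → Type*} [∀ k, MeasurableSpace (E k)]
    (P₀ P₁ : ∀ k, Measure (ℕ → E k)) (l u : ℕ) (a b c d : ℝ) : DecisionRule E where
  T _ ω := syncTime l u a b c d fun n => obsLLR P₀ P₁ n ω
  D ω := syncDecision l u a b c d fun n => obsLLR P₀ P₁ n ω

/-- The minimum of the numbers `r k` over `k ∈ S`, which is `∞` if `S` is empty. -/
noncomputable def minOver (r : Fin K → ℝ) (S : Finset (Fin K)) : ℝ≥0∞ :=
  ⨅ k ∈ S, ENNReal.ofReal (r k)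

/-- The first-order approximation
`max {|log α| / (I_A + J_A 1{|A| = l}), |log β| / (J_A + I_A 1{|A| = u})}`, where `I_A` is the
minimum of `I` over `A` and `J_A` is the minimum of `J` over the complement of `A`. -/
noncomputable def syncRate (I J : Fin K → ℝ) (l u : ℕ) (A : Finset (Fin K)) (α β : ℝ) : ℝ≥0∞ :=
  max
    (ENNReal.ofReal |Real.log α| / (minOver I A + if A.card = l then minOver J Aᶜ else 0))
    (ENNReal.ofReal |Real.log β| / (minOver J Aᶜ + if A.card = u then minOver I A else 0))

end Synchronous

/-- `f ∼ g` as `α, β ↓ 0`: the ratio tends to `1`. -/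
def AsympEquiv (f g : ℝ → ℝ → ℝ≥0∞) : Prop :=
  Tendsto (fun p : ℝ × ℝ => f p.1 p.2 / g p.1 p.2) (𝓝[>] 0 ×ˢ 𝓝[>] 0) (𝓝 1)

/-- A threshold `h(α, β)` satisfies `h ∼ |log γ|` as `α, β ↓ 0`, where `γ = γ(α, β)`. -/
def ThresholdEquiv (h : ℝ → ℝ → ℝ) (γ : ℝ × ℝ → ℝ) : Prop :=
  Tendsto (fun p : ℝ × ℝ => h p.1 p.2 / |Real.log (γ p)|) (𝓝[>] 0 ×ˢ 𝓝[>] 0) (𝓝 1)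

end SeqMT

open SeqMT

/-! Lower bound. Let `A'` be a set of the class that misses a signal of `A`. A test controlling both
errors must tell `A` from `A'`, so a change of measure at the time it stops shows that, under `A`,
the log-likelihood ratio of `A` against `A'` has to reach about `|log α|`. It grows at most at
the rate `∑ k ∈ A \ A', I k + ∑ k ∈ A' \ A, J k`. The nearest such `A'` drops one signal or, if
`A` has the minimal size `l`, exchanges it for a noise; its rate is the first denominator of the
theorem. The second one is obtained in the same way from the sets that contain a noise of `A`.

Upper bound. At every time at which the log-likelihood ratio of each stream has grown at
`1 - ε` times its rate, and which exceeds the claimed rate by the factor `1 / (1 - ε)`, the test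
has stopped. By complete convergence the expected number of times at which this growth fails is
finite, hence negligible in comparison with the rate. -/

namespace SeqMT

section ProductMeasures

variable {ι : Type*} [Fintype ι] {X : ι → Type*}

open ProbabilityTheory in
theorem lintegral_pi_prod [∀ i, MeasurableSpace (X i)] (μ : ∀ i, Measure (X i))
    [∀ i, IsProbabilityMeasure (μ i)] {f : ∀ i, X i → ℝ≥0∞} (hf : ∀ i, Measurable (f i)) :
    ∫⁻ x, ∏ i, f i (x i) ∂Measure.pi μ = ∏ i, ∫⁻ x, f i x ∂μ i := by
  have hindep : iIndepFun (fun i (x : ∀ i, X i) => f i (x i)) (Measure.pi μ) :=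
    iIndepFun_pi fun i => (hf i).aemeasurable
  rw [lintegral_prod_eq_prod_lintegral_of_indepFun Finset.univ _ hindep
    fun i => (hf i).comp (measurable_pi_apply i)]
  exact Finset.prod_congr rfl fun i _ => (measurePreserving_eval μ i).lintegral_comp (hf i)

theorem pi_withDensity [∀ i, MeasurableSpace (X i)] (μ : ∀ i, Measure (X i))
    [∀ i, IsProbabilityMeasure (μ i)] {f : ∀ i, X i → ℝ≥0∞} (hf : ∀ i, Measurable (f i))
    [∀ i, SigmaFinite ((μ i).withDensity (f i))] :
    Measure.pi (fun i => (μ i).withDensity (f i)) =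
      (Measure.pi μ).withDensity fun x => ∏ i, f i (x i) := by
  refine Measure.pi_eq fun B hB => ?_
  have hindicator : (Set.univ.pi B).indicator (fun x => ∏ i, f i (x i)) =
      fun x => ∏ i, (B i).indicator (f i) (x i) := by
    classical
    ext x
    simp only [Set.indicator_apply, Finset.prod_ite_zero, Set.mem_univ_pi, Finset.mem_univ,
      true_implies]
  rw [withDensity_apply _ (MeasurableSet.univ_pi hB),
    ← lintegral_indicator (MeasurableSet.univ_pi hB), hindicator,
    lintegral_pi_prod μ fun i => (hf i).indicator (hB i)]
  refine Finset.prod_congr rfl fun i _ => ?_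
  rw [lintegral_indicator (hB i), withDensity_apply _ (hB i)]

theorem pi_trim {m m₀ : ∀ i, MeasurableSpace (X i)} (hm : ∀ i, m i ≤ m₀ i)
    (μ : ∀ i, Measure (X i)) [∀ i, IsFiniteMeasure (μ i)]
    (hpi : @MeasurableSpace.pi _ _ m ≤ MeasurableSpace.pi) :
    (Measure.pi μ).trim hpi = @Measure.pi _ _ _ m fun i => (μ i).trim (hm i) := by
  have (i : ι) : IsFiniteMeasure ((μ i).trim (hm i)) := isFiniteMeasure_trim (hm i)
  refine (@Measure.pi_eq _ _ _ m _ (fun i => inferInstance) _ fun B hB => ?_).symm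
  rw [trim_measurableSet_eq hpi (@MeasurableSet.univ_pi _ _ m _ _ hB), Measure.pi_pi]
  exact Finset.prod_congr rfl fun i _ => (trim_measurableSet_eq (hm i) (hB i)).symm

theorem pi_apply_eq_of_trim_eq {m m₀ : ∀ i, MeasurableSpace (X i)} (hm : ∀ i, m i ≤ m₀ i)
    {μ ν : ∀ i, Measure (X i)} [∀ i, IsFiniteMeasure (μ i)] [∀ i, IsFiniteMeasure (ν i)]
    (h : ∀ i, (μ i).trim (hm i) = (ν i).trim (hm i)) {G : Set (∀ i, X i)}
    (hG : MeasurableSet[@MeasurableSpace.pi _ _ m] G) :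
    Measure.pi μ G = Measure.pi ν G := by
  have hpi : @MeasurableSpace.pi _ _ m ≤ MeasurableSpace.pi :=
    iSup_mono fun i => MeasurableSpace.comap_mono (hm i)
  rw [← trim_measurableSet_eq hpi hG, ← trim_measurableSet_eq hpi hG, pi_trim hm, pi_trim hm]
  simp only [h]

end ProductMeasures

section Stream

variable {E : Type*} [MeasurableSpace E] {μ₁ μ₀ : Measure (ℕ → E)}

theorem LocallyEquivalent.refl (μ : Measure (ℕ → E)) : LocallyEquivalent μ μ :=
  fun _ _ => ⟨.rfl, .rfl⟩

theorem LocallyEquivalent.symm (h : LocallyEquivalent μ₁ μ₀) : LocallyEquivalent μ₀ μ₁ :=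
  fun n hn => (h n hn).symm

theorem measurable_streamLLR (μ₁ μ₀ : Measure (ℕ → E)) (n : ℕ) :
    Measurable[streamSigma E n] (streamLLR μ₁ μ₀ n) :=
  @measurable_llr _ (streamSigma E n) (restrictLaw μ₁ n) (restrictLaw μ₀ n)

instance [IsProbabilityMeasure μ₁] (n : ℕ) : IsProbabilityMeasure (restrictLaw μ₁ n) :=
  ⟨by rw [restrictLaw, trim_measurableSet_eq _ .univ, measure_univ]⟩

theorem restrictLaw_withDensity_streamLLR [IsProbabilityMeasure μ₁] [IsProbabilityMeasure μ₀]
    (h : LocallyEquivalent μ₁ μ₀) {n : ℕ} (hn : 1 ≤ n) :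
    restrictLaw (μ₀.withDensity fun x => .ofReal (Real.exp (streamLLR μ₁ μ₀ n x))) n =
      restrictLaw μ₁ n := by
  refine @Measure.ext _ (streamSigma E n) _ _ fun B hB => ?_
  rw [restrictLaw, trim_measurableSet_eq _ hB, withDensity_apply _ (streamSigma_le n _ hB),
    ← setLIntegral_trim (streamSigma_le n) (measurable_streamLLR μ₁ μ₀ n).exp.ennreal_ofReal hB,
    ← Measure.setLIntegral_rnDeriv (h n hn).1]
  refine lintegral_congr_ae (ae_restrict_of_ae ?_)
  filter_upwards [exp_llr_of_ac' (restrictLaw μ₁ n) (restrictLaw μ₀ n) (h n hn).2,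
    Measure.rnDeriv_lt_top (restrictLaw μ₁ n) (restrictLaw μ₀ n)] with x hx hx'
  rw [streamLLR, hx, ENNReal.ofReal_toReal hx'.ne]

end Stream

section GrowthRate

/-- `f n ≤ r n + o(n)` as `n → ∞`, that is, `limsup f(n)/n ≤ r`. The formulation by eventual
inequalities avoids both the junk values of a real `limsup` and the arithmetic of `EReal`. -/
def GrowthRateLE (f : ℕ → ℝ) (r : ℝ) : Prop :=
  ∀ C : ℝ, r < C → ∀ᶠ n : ℕ in atTop, f n ≤ C * n

namespace GrowthRateLE

variable {f : ℕ → ℝ} {r : ℝ}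

theorem of_limsup_le (h : limsup (fun n : ℕ => ((f n / n : ℝ) : EReal)) atTop ≤ r) :
    GrowthRateLE f r := by
  intro C hC
  filter_upwards [eventually_lt_of_limsup_lt (h.trans_lt (EReal.coe_lt_coe_iff.2 hC)),
    eventually_gt_atTop 0] with n hn hn0
  exact ((div_lt_iff₀ (Nat.cast_pos.2 hn0)).1 (EReal.coe_lt_coe_iff.1 hn)).le

theorem zero : GrowthRateLE 0 0 :=
  fun _ hC => .of_forall fun n => mul_nonneg hC.le n.cast_nonneg

theorem add {g : ℕ → ℝ} {s : ℝ} (hf : GrowthRateLE f r) (hg : GrowthRateLE g s) :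
    GrowthRateLE (f + g) (r + s) := by
  intro C hC
  filter_upwards [hf (r + (C - (r + s)) / 2) (by linarith),
    hg (s + (C - (r + s)) / 2) (by linarith)] with n hfn hgn
  simp only [Pi.add_apply]
  linarith

theorem sum {ι : Type*} {f : ι → ℕ → ℝ} {r : ι → ℝ} (S : Finset ι)
    (h : ∀ i ∈ S, GrowthRateLE (f i) (r i)) : GrowthRateLE (∑ i ∈ S, f i) (∑ i ∈ S, r i) := by
  classical
  induction S using Finset.induction_on with
  | empty => simpa only [Finset.sum_empty] using zero
  | insert i S hi ih =>
    rw [Finset.sum_insert hi, Finset.sum_insert hi]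
    exact (h i (Finset.mem_insert_self i S)).add
      (ih fun j hj => h j (Finset.mem_insert_of_mem hj))

theorem eventually_forall_le (h : GrowthRateLE f r) {C : ℝ} (hr : r < C) (hC : 0 < C) :
    ∀ᶠ n : ℕ in atTop, ∀ m ≤ n, f m ≤ C * n := by
  obtain ⟨M, hM⟩ := eventually_atTop.1 (h C hr)
  obtain ⟨B, hB⟩ := ((Finset.range M).image f).bddAbove
  have hlim : Tendsto (fun n : ℕ => C * (n : ℝ)) atTop atTop :=
    tendsto_natCast_atTop_atTop.const_mul_atTop hC
  filter_upwards [hlim.eventually_ge_atTop B] with n hn m hmn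
  rcases lt_or_ge m M with hm | hm
  · exact (hB (Finset.mem_coe.2 (Finset.mem_image_of_mem f (Finset.mem_range.2 hm)))).trans hn
  · exact (hM m hm).trans (by gcongr)

end GrowthRateLE

end GrowthRate

section LogLikelihoodRatio

variable {Ω : Type*} [m₀ : MeasurableSpace Ω]

/-- The process `L` is a version of the log-likelihood ratio of `P` against `Q` along the
filtration `ℱ`. The first observation is available at time `1`, so nothing is required of the
densities at time `0`. -/
structure IsLogLikelihoodRatio (ℱ : Filtration ℕ m₀) (P Q : Measure Ω) (L : ℕ → Ω → ℝ) :
    Prop where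
  measurable (n : ℕ) : Measurable[ℱ n] (L n)
  apply_eq_setLIntegral {n : ℕ} (hn : 1 ≤ n) {G : Set Ω} (hG : MeasurableSet[ℱ n] G) :
    P G = ∫⁻ ω in G, ENNReal.ofReal (Real.exp (L n ω)) ∂Q

namespace IsLogLikelihoodRatio

variable {ℱ : Filtration ℕ m₀} {P Q : Measure Ω} {L : ℕ → Ω → ℝ}

theorem measure_inter_le (hL : IsLogLikelihoodRatio ℱ P Q L) {n : ℕ} (hn : 1 ≤ n) {G : Set Ω}
    (hG : MeasurableSet[ℱ n] G) (C : ℝ) :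
    P (G ∩ {ω | L n ω ≤ C}) ≤ .ofReal (Real.exp C) * Q G := by
  have hGC : MeasurableSet[ℱ n] (G ∩ {ω | L n ω ≤ C}) :=
    hG.inter (hL.measurable n measurableSet_Iic)
  rw [hL.apply_eq_setLIntegral hn hGC]
  calc ∫⁻ ω in G ∩ {ω | L n ω ≤ C}, ENNReal.ofReal (Real.exp (L n ω)) ∂Q
      ≤ ∫⁻ _ in G ∩ {ω | L n ω ≤ C}, ENNReal.ofReal (Real.exp C) ∂Q :=
        setLIntegral_mono' (ℱ.le n _ hGC) fun ω hω =>
          ENNReal.ofReal_le_ofReal (Real.exp_le_exp.2 hω.2)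
    _ = .ofReal (Real.exp C) * Q (G ∩ {ω | L n ω ≤ C}) := setLIntegral_const _ _
    _ ≤ .ofReal (Real.exp C) * Q G := by gcongr; exact Set.inter_subset_left

theorem measure_stop_le (hL : IsLogLikelihoodRatio ℱ P Q L) {T : Ω → ℕ∞} {S : Set Ω}
    (hS : ∀ m : ℕ, 1 ≤ m → MeasurableSet[ℱ m] ({ω | T ω = m} ∩ S)) (n : ℕ) (C : ℝ) :
    P (⋃ m ∈ Finset.Icc 1 n, ({ω | T ω = m} ∩ S) ∩ {ω | L m ω ≤ C}) ≤
      .ofReal (Real.exp C) * Q S := by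
  have hdisj : Set.PairwiseDisjoint ↑(Finset.Icc 1 n) fun m : ℕ => {ω | T ω = m} ∩ S :=
    fun i _ j _ hij => Set.disjoint_left.2 fun ω hi hj =>
      hij (by exact_mod_cast hi.1.symm.trans hj.1)
  calc P (⋃ m ∈ Finset.Icc 1 n, ({ω | T ω = m} ∩ S) ∩ {ω | L m ω ≤ C})
      ≤ ∑ m ∈ Finset.Icc 1 n, P (({ω | T ω = m} ∩ S) ∩ {ω | L m ω ≤ C}) :=
        measure_biUnion_finset_le _ _
    _ ≤ ∑ m ∈ Finset.Icc 1 n, .ofReal (Real.exp C) * Q ({ω | T ω = m} ∩ S) :=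
        Finset.sum_le_sum fun m hm =>
          hL.measure_inter_le (Finset.mem_Icc.1 hm).1 (hS m (Finset.mem_Icc.1 hm).1) C
    _ = .ofReal (Real.exp C) * Q (⋃ m ∈ Finset.Icc 1 n, {ω | T ω = m} ∩ S) := by
        rw [← Finset.mul_sum, measure_biUnion_finset hdisj
          fun m hm => ℱ.le m _ (hS m (Finset.mem_Icc.1 hm).1)]
    _ ≤ .ofReal (Real.exp C) * Q S := by
        gcongr
        exact Set.iUnion₂_subset fun m _ => Set.inter_subset_right

theorem measure_time_le (hL : IsLogLikelihoodRatio ℱ P Q L) {T : Ω → ℕ∞} (hT : ∀ ω, 1 ≤ T ω)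
    {S : Set Ω} (hS : ∀ m : ℕ, 1 ≤ m → MeasurableSet[ℱ m] ({ω | T ω = m} ∩ S)) (n : ℕ) (C : ℝ) :
    P {ω | T ω ≤ n} ≤
      P Sᶜ + .ofReal (Real.exp C) * Q S + P {ω | ∃ m ≤ n, C < L m ω} := by
  have hcover : {ω | T ω ≤ n} ⊆
      Sᶜ ∪ (⋃ m ∈ Finset.Icc 1 n, ({ω | T ω = m} ∩ S) ∩ {ω | L m ω ≤ C}) ∪
        {ω | ∃ m ≤ n, C < L m ω} := by
    intro ω (hω : T ω ≤ n)
    obtain ⟨m, hm⟩ := ENat.ne_top_iff_exists.1 (ne_top_of_le_ne_top (ENat.natCast_ne_top n) hω)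
    have hm1 : 1 ≤ m := by exact_mod_cast (hT ω).trans_eq hm.symm
    have hmn : m ≤ n := by exact_mod_cast hm.trans_le hω
    by_cases hωS : ω ∈ S
    · rcases le_or_gt (L m ω) C with hC | hC
      · exact .inl (.inr (Set.mem_biUnion (Finset.mem_Icc.2 ⟨hm1, hmn⟩) ⟨⟨hm.symm, hωS⟩, hC⟩))
      · exact .inr ⟨m, hmn, hC⟩
    · exact .inl (.inl hωS)
  refine (measure_mono hcover).trans ((measure_union_le _ _).trans ?_)
  gcongr
  refine (measure_union_le _ _).trans ?_
  gcongr
  exact hL.measure_stop_le hS n C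

theorem tendsto_measure_exists_gt [IsFiniteMeasure P] (hL : IsLogLikelihoodRatio ℱ P Q L)
    {r C : ℝ} (hrate : ∀ᵐ ω ∂P, GrowthRateLE (fun n => L n ω) r) (hr : r < C) (hC : 0 < C) :
    Tendsto (fun n : ℕ => P {ω | ∃ m ≤ n, C * n < L m ω}) atTop (𝓝 0) := by
  have hmeas (n : ℕ) : MeasurableSet {ω | ∃ m ≤ n, C * n < L m ω} := by
    simp only [Set.ofPred_exists, Set.ofPred_and]
    exact .iUnion fun m => .inter (.const _) (ℱ.le m _ (hL.measurable m measurableSet_Ioi))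
  rw [← measure_empty (μ := P)]
  refine tendsto_measure_of_ae_tendsto_indicator_of_isFiniteMeasure atTop .empty hmeas ?_
  filter_upwards [hrate] with ω hω
  filter_upwards [hω.eventually_forall_le hr hC] with n hn
  simpa only [Set.mem_ofPred_eq, Set.mem_empty_iff_false, iff_false, not_exists, not_and, not_lt]
    using hn

end IsLogLikelihoodRatio

theorem mul_one_sub_measure_le_lintegral (μ : Measure Ω) [IsProbabilityMeasure μ] {T : Ω → ℕ∞}
    {n : ℕ} (hT : MeasurableSet {ω | T ω ≤ n}) :
    ((n + 1 : ℕ) : ℝ≥0∞) * (1 - μ {ω | T ω ≤ n}) ≤ ∫⁻ ω, (T ω : ℝ≥0∞) ∂μ := by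
  rw [← prob_compl_eq_one_sub hT, ← lintegral_indicator_const hT.compl]
  refine lintegral_mono (Set.indicator_le fun ω hω => ?_)
  have hsucc : ((n + 1 : ℕ) : ℕ∞) ≤ T ω := by
    push_cast
    exact Order.add_one_le_of_lt (not_le.1 hω)
  exact_mod_cast ENat.toENNReal_le.2 hsucc

theorem tendsto_abs_log_nhdsGT_zero : Tendsto (fun γ => |Real.log γ|) (𝓝[>] 0) atTop :=
  tendsto_abs_atBot_atTop.comp Real.tendsto_log_nhdsGT_zero

theorem exp_mul_floor_mul_le {R θ γ : ℝ} (hR : 0 < R) (hθ : 0 < θ) (hθ1 : θ < 1) (hγ : 0 < γ)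
    (hγ1 : γ < 1) :
    Real.exp (R * (1 + θ) * ⌊(1 - θ) * (|Real.log γ| / R)⌋₊) * γ ≤
      Real.exp (-(θ ^ 2 * |Real.log γ|)) := by
  have hlog : |Real.log γ| = -Real.log γ := abs_of_neg (Real.log_neg hγ hγ1)
  have hexponent : R * (1 + θ) * ⌊(1 - θ) * (|Real.log γ| / R)⌋₊ ≤ (1 - θ ^ 2) * |Real.log γ| :=
    calc R * (1 + θ) * ⌊(1 - θ) * (|Real.log γ| / R)⌋₊
        ≤ R * (1 + θ) * ((1 - θ) * (|Real.log γ| / R)) := by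
          gcongr
          exact Nat.floor_le (mul_nonneg (by linarith) (by positivity))
      _ = (1 - θ ^ 2) * |Real.log γ| := by field_simp; ring
  nth_rewrite 2 [← Real.exp_log hγ]
  rw [← Real.exp_add]
  exact Real.exp_le_exp.2 (by linarith)

namespace IsLogLikelihoodRatio

variable {ℱ : Filtration ℕ m₀} {P Q : Measure Ω} {L : ℕ → Ω → ℝ}

theorem eventually_measure_time_le [IsFiniteMeasure P] (hL : IsLogLikelihoodRatio ℱ P Q L)
    {R : ℝ} (hR : 0 < R) (hrate : ∀ᵐ ω ∂P, GrowthRateLE (fun n => L n ω) R) {θ : ℝ}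
    (hθ : 0 < θ) (hθ1 : θ < 1) :
    ∀ᶠ p : ℝ × ℝ in 𝓝[>] 0 ×ˢ 𝓝[>] 0, ∀ (T : Ω → ℕ∞) (S : Set Ω), (∀ ω, 1 ≤ T ω) →
      (∀ m : ℕ, 1 ≤ m → MeasurableSet[ℱ m] ({ω | T ω = m} ∩ S)) →
      P Sᶜ ≤ .ofReal p.2 → Q S ≤ .ofReal p.1 →
      P {ω | T ω ≤ ⌊(1 - θ) * (|Real.log p.1| / R)⌋₊} ≤ .ofReal θ := by
  set C : ℝ := R * (1 + θ)
  set N : ℝ → ℕ := fun γ => ⌊(1 - θ) * (|Real.log γ| / R)⌋₊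
  have hNlim : Tendsto N (𝓝[>] 0) atTop :=
    tendsto_nat_floor_atTop.comp
      ((tendsto_abs_log_nhdsGT_zero.atTop_div_const hR).const_mul_atTop (by linarith))
  have hexceed : Tendsto (fun γ => P {ω | ∃ m ≤ N γ, C * N γ < L m ω}) (𝓝[>] 0) (𝓝 0) :=
    (hL.tendsto_measure_exists_gt hrate (by nlinarith [mul_pos hR hθ]) (by positivity)).comp hNlim
  have hexp : Tendsto (fun γ => ENNReal.ofReal (Real.exp (-(θ ^ 2 * |Real.log γ|))))
      (𝓝[>] 0) (𝓝 0) := by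
    rw [← ENNReal.ofReal_zero]
    exact ENNReal.tendsto_ofReal (Real.tendsto_exp_neg_atTop_nhds_zero.comp
      (tendsto_abs_log_nhdsGT_zero.const_mul_atTop (by positivity)))
  have hη : Tendsto ENNReal.ofReal (𝓝[>] 0) (𝓝 0) := by
    rw [← ENNReal.ofReal_zero]
    exact ENNReal.tendsto_ofReal nhdsWithin_le_nhds
  have hsum := ((hη.comp tendsto_snd).add (hexp.comp tendsto_fst)).add
    (hexceed.comp (tendsto_fst (f := 𝓝[>] (0 : ℝ)) (g := 𝓝[>] (0 : ℝ))))
  simp only [add_zero] at hsum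
  filter_upwards [hsum.eventually_lt_const (ENNReal.ofReal_pos.2 hθ),
    tendsto_fst.eventually (Ioo_mem_nhdsGT one_pos)] with ⟨γ, η⟩ hp ⟨hγ0, hγ1⟩ T S hT hS hP hQ
  have hrare : .ofReal (Real.exp (C * N γ)) * Q S ≤
      ENNReal.ofReal (Real.exp (-(θ ^ 2 * |Real.log γ|))) :=
    calc .ofReal (Real.exp (C * N γ)) * Q S
        ≤ .ofReal (Real.exp (C * N γ)) * ENNReal.ofReal γ := by gcongr
      _ = .ofReal (Real.exp (C * N γ) * γ) := (ENNReal.ofReal_mul (Real.exp_pos _).le).symm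
      _ ≤ _ := ENNReal.ofReal_le_ofReal (exp_mul_floor_mul_le hR hθ hθ1 hγ0 hγ1)
  calc P {ω | T ω ≤ N γ}
      ≤ P Sᶜ + .ofReal (Real.exp (C * N γ)) * Q S + P {ω | ∃ m ≤ N γ, C * N γ < L m ω} :=
        hL.measure_time_le hT hS (N γ) (C * N γ)
    _ ≤ .ofReal η + .ofReal (Real.exp (-(θ ^ 2 * |Real.log γ|))) +
        P {ω | ∃ m ≤ N γ, C * N γ < L m ω} := by gcongr
    _ ≤ .ofReal θ := hp.le

theorem eventually_le_lintegral [IsProbabilityMeasure P] (hL : IsLogLikelihoodRatio ℱ P Q L)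
    {R : ℝ} (hR : 0 < R) (hrate : ∀ᵐ ω ∂P, GrowthRateLE (fun n => L n ω) R) {δ : ℝ}
    (hδ : 0 < δ) (hδ1 : δ < 1) :
    ∀ᶠ p : ℝ × ℝ in 𝓝[>] 0 ×ˢ 𝓝[>] 0, ∀ (T : Ω → ℕ∞) (S : Set Ω), IsStoppingTime ℱ T →
      (∀ ω, 1 ≤ T ω) → (∀ m : ℕ, 1 ≤ m → MeasurableSet[ℱ m] ({ω | T ω = m} ∩ S)) →
      P Sᶜ ≤ .ofReal p.2 → Q S ≤ .ofReal p.1 →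
      .ofReal ((1 - δ) * (|Real.log p.1| / R)) ≤ ∫⁻ ω, (T ω : ℝ≥0∞) ∂P := by
  set θ : ℝ := δ / 2 with hθ
  filter_upwards [hL.eventually_measure_time_le hR hrate (θ := θ) (by linarith) (by linarith)]
    with ⟨γ, η⟩ hearly T S hT hT1 hS hP hQ
  set x : ℝ := |Real.log γ| / R
  set N : ℕ := ⌊(1 - θ) * x⌋₊
  have hxN : (1 - θ) * x ≤ (N + 1 : ℕ) := by
    push_cast
    exact (Nat.lt_floor_add_one _).le
  have hx0 : 0 ≤ x := by positivity
  calc ENNReal.ofReal ((1 - δ) * x) ≤ .ofReal ((N + 1 : ℕ) * (1 - θ)) := by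
        refine ENNReal.ofReal_le_ofReal ?_
        nlinarith [mul_nonneg hx0 (sq_nonneg θ),
          mul_le_mul_of_nonneg_right hxN (show 0 ≤ 1 - θ by linarith)]
    _ = (N + 1 : ℕ) * (1 - .ofReal θ) := by
        rw [ENNReal.ofReal_mul (by positivity), ENNReal.ofReal_natCast,
          ENNReal.ofReal_sub _ (by linarith), ENNReal.ofReal_one]
    _ ≤ (N + 1 : ℕ) * (1 - P {ω | T ω ≤ N}) := by
        gcongr
        exact hearly T S hT1 hS hP hQ
    _ ≤ ∫⁻ ω, (T ω : ℝ≥0∞) ∂P :=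
        mul_one_sub_measure_le_lintegral P (ℱ.le N _ (hT.measurableSet_le N))

end IsLogLikelihoodRatio

end LogLikelihoodRatio

section JointLaw

variable {K : ℕ} {E : Fin K → Type*} [∀ k, MeasurableSpace (E k)]

/-- The log-likelihood ratio of the first `n` observations for the joint law of independent
streams with laws `Q k` against the one with laws `Q' k`. -/
noncomputable def jointLLR (Q Q' : ∀ k, Measure (ℕ → E k)) (n : ℕ) (ω : Obs E) : ℝ :=
  ∑ k, streamLLR (Q k) (Q' k) n (ω k)

theorem measurable_streamLLR_eval (Q Q' : ∀ k, Measure (ℕ → E k)) (n : ℕ) (k : Fin K) :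
    Measurable[obsFiltration E n] fun ω : Obs E => streamLLR (Q k) (Q' k) n (ω k) :=
  (measurable_streamLLR (Q k) (Q' k) n).comp <| measurable_iff_comap_le.2 <|
    le_iSup (fun k => MeasurableSpace.comap (fun ω : Obs E => ω k) (streamSigma (E k) n)) k

theorem isLogLikelihoodRatio_jointLLR {Q Q' : ∀ k, Measure (ℕ → E k)}
    [∀ k, IsProbabilityMeasure (Q k)] [∀ k, IsProbabilityMeasure (Q' k)]
    (h : ∀ k, LocallyEquivalent (Q k) (Q' k)) :
    IsLogLikelihoodRatio (obsFiltration E) (Measure.pi Q) (Measure.pi Q') (jointLLR Q Q') where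
  measurable n := Finset.measurable_fun_sum _ fun k _ => measurable_streamLLR_eval Q Q' n k
  apply_eq_setLIntegral {n} hn G hG := by
    set f : ∀ k, (ℕ → E k) → ℝ≥0∞ :=
      fun k x => .ofReal (Real.exp (streamLLR (Q k) (Q' k) n x)) with hf
    have hf_meas (k : Fin K) : Measurable (f k) :=
      ((measurable_streamLLR _ _ n).mono (streamSigma_le n) le_rfl).exp.ennreal_ofReal
    have htrim (k : Fin K) : restrictLaw ((Q' k).withDensity (f k)) n = restrictLaw (Q k) n :=
      restrictLaw_withDensity_streamLLR (h k) hn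
    have (k : Fin K) : IsFiniteMeasure ((Q' k).withDensity (f k)) := ⟨by
      rw [← trim_measurableSet_eq (streamSigma_le n) .univ, ← restrictLaw, htrim]
      exact measure_lt_top _ _⟩
    calc Measure.pi Q G = Measure.pi (fun k => (Q' k).withDensity (f k)) G :=
          pi_apply_eq_of_trim_eq (fun _ => streamSigma_le n) (fun k => (htrim k).symm) hG
      _ = ∫⁻ ω in G, ∏ k, f k (ω k) ∂Measure.pi Q' := by
          rw [pi_withDensity Q' hf_meas, withDensity_apply _ ((obsFiltration E).le n _ hG)]
      _ = ∫⁻ ω in G, .ofReal (Real.exp (jointLLR Q Q' n ω)) ∂Measure.pi Q' := by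
          simp only [hf, jointLLR, Real.exp_sum,
            ENNReal.ofReal_prod_of_nonneg fun _ _ => (Real.exp_pos _).le]

/-- The law of stream `k` when `A` is the set of signals. -/
noncomputable def streamLaw (P₀ P₁ : ∀ k, Measure (ℕ → E k)) (A : Finset (Fin K)) (k : Fin K) :
    Measure (ℕ → E k) :=
  if k ∈ A then P₁ k else P₀ k

variable {P₀ P₁ : ∀ k, Measure (ℕ → E k)} {A A' : Finset (Fin K)} {k : Fin K}

theorem streamLaw_of_mem (hk : k ∈ A) : streamLaw P₀ P₁ A k = P₁ k := if_pos hk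

theorem streamLaw_of_notMem (hk : k ∉ A) : streamLaw P₀ P₁ A k = P₀ k := if_neg hk

theorem jointLaw_eq_pi_streamLaw : jointLaw P₀ P₁ A = Measure.pi (streamLaw P₀ P₁ A) := rfl

theorem locallyEquivalent_streamLaw (h : ∀ k, LocallyEquivalent (P₁ k) (P₀ k)) (k : Fin K) :
    LocallyEquivalent (streamLaw P₀ P₁ A k) (streamLaw P₀ P₁ A' k) := by
  unfold streamLaw
  split_ifs
  exacts [.refl _, h k, (h k).symm, .refl _]

variable [∀ k, IsProbabilityMeasure (P₀ k)] [∀ k, IsProbabilityMeasure (P₁ k)]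

instance : IsProbabilityMeasure (streamLaw P₀ P₁ A k) := by
  unfold streamLaw
  split_ifs <;> infer_instance

instance : IsProbabilityMeasure (jointLaw P₀ P₁ A) := by
  rw [jointLaw_eq_pi_streamLaw]
  infer_instance

end JointLaw

section DivergenceRate

theorem ae_growthRateLE_streamLLR_self {E : Type*} [MeasurableSpace E] (μ : Measure (ℕ → E))
    [IsProbabilityMeasure μ] : ∀ᵐ x ∂μ, GrowthRateLE (fun n => streamLLR μ μ n x) 0 := by
  have hzero : ∀ᵐ x ∂μ, ∀ n, streamLLR μ μ n x = 0 :=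
    ae_all_iff.2 fun n => ae_of_ae_trim (streamSigma_le n) (llr_self (restrictLaw μ n))
  filter_upwards [hzero] with x hx
  simp only [hx]
  exact .zero

theorem LimsupRateLE.ae_growthRateLE {E : Type*} [MeasurableSpace E] {μ : Measure (ℕ → E)}
    {ξ : ℕ → (ℕ → E) → ℝ} {r : ℝ} (h : LimsupRateLE μ ξ r) :
    ∀ᵐ x ∂μ, GrowthRateLE (fun n => ξ n x) r :=
  h.mono fun _ => GrowthRateLE.of_limsup_le

theorem LimsupRateLE.ae_growthRateLE_swap {E : Type*} [MeasurableSpace E]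
    {μ₁ μ₀ : Measure (ℕ → E)} [IsProbabilityMeasure μ₁] [IsProbabilityMeasure μ₀]
    (hequiv : LocallyEquivalent μ₁ μ₀) {r : ℝ}
    (h : LimsupRateLE μ₀ (fun n x => -streamLLR μ₁ μ₀ n x) r) :
    ∀ᵐ x ∂μ₀, GrowthRateLE (fun n => streamLLR μ₀ μ₁ n x) r := by
  have hneg : ∀ᵐ x ∂μ₀, ∀ n, 1 ≤ n → -streamLLR μ₁ μ₀ n x = streamLLR μ₀ μ₁ n x :=
    ae_all_iff.2 fun n => eventually_imp_distrib_left.2 fun hn =>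
      ae_of_ae_trim (streamSigma_le n)
        ((hequiv n hn).2 (neg_llr (hequiv n hn).1))
  filter_upwards [hneg, h.ae_growthRateLE] with x hx hrate C hC
  filter_upwards [hrate C hC, eventually_ge_atTop 1] with n hn hn1
  rwa [← hx n hn1]

variable {K : ℕ} {E : Fin K → Type*} [∀ k, MeasurableSpace (E k)]

/-- The asymptotic drift, when `A` is the set of signals, of the log-likelihood ratio of `A`
against `A'`. -/
noncomputable def divergenceRate (I J : Fin K → ℝ) (A A' : Finset (Fin K)) : ℝ :=
  ∑ k ∈ A \ A', I k + ∑ k ∈ A' \ A, J k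

variable {P₀ P₁ : ∀ k, Measure (ℕ → E k)} [∀ k, IsProbabilityMeasure (P₀ k)]
  [∀ k, IsProbabilityMeasure (P₁ k)] {I J : Fin K → ℝ}

theorem ae_growthRateLE_streamLLR (hequiv : ∀ k, LocallyEquivalent (P₁ k) (P₀ k))
    (hsup₁ : ∀ k, LimsupRateLE (P₁ k) (fun n => streamLLR (P₁ k) (P₀ k) n) (I k))
    (hsup₀ : ∀ k, LimsupRateLE (P₀ k) (fun n x => -streamLLR (P₁ k) (P₀ k) n x) (J k))
    (A A' : Finset (Fin K)) (k : Fin K) :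
    ∀ᵐ x ∂streamLaw P₀ P₁ A k,
      GrowthRateLE (fun n => streamLLR (streamLaw P₀ P₁ A k) (streamLaw P₀ P₁ A' k) n x)
        ((if k ∈ A \ A' then I k else 0) + if k ∈ A' \ A then J k else 0) := by
  by_cases hA : k ∈ A <;> by_cases hA' : k ∈ A' <;>
    simp only [Finset.mem_sdiff, hA, hA', not_true_eq_false, not_false_eq_true, and_self,
      and_true, and_false, if_true, if_false, add_zero, zero_add, streamLaw_of_mem,
      streamLaw_of_notMem]
  · exact ae_growthRateLE_streamLLR_self (P₁ k)
  · exact (hsup₁ k).ae_growthRateLE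
  · exact (hsup₀ k).ae_growthRateLE_swap (hequiv k)
  · exact ae_growthRateLE_streamLLR_self (P₀ k)

theorem ae_growthRateLE_jointLLR (hequiv : ∀ k, LocallyEquivalent (P₁ k) (P₀ k))
    (hsup₁ : ∀ k, LimsupRateLE (P₁ k) (fun n => streamLLR (P₁ k) (P₀ k) n) (I k))
    (hsup₀ : ∀ k, LimsupRateLE (P₀ k) (fun n x => -streamLLR (P₁ k) (P₀ k) n x) (J k))
    (A A' : Finset (Fin K)) :
    ∀ᵐ ω ∂jointLaw P₀ P₁ A,
      GrowthRateLE (fun n => jointLLR (streamLaw P₀ P₁ A) (streamLaw P₀ P₁ A') n ω)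
        (divergenceRate I J A A') := by
  have hstream (k : Fin K) := (measurePreserving_eval (streamLaw P₀ P₁ A)
    k).quasiMeasurePreserving.ae (ae_growthRateLE_streamLLR hequiv hsup₁ hsup₀ A A' k)
  filter_upwards [ae_all_iff.2 hstream] with ω hω
  convert GrowthRateLE.sum Finset.univ fun k _ => hω k using 1
  · ext n
    simp only [jointLLR, Finset.sum_apply, Function.eval]
  · rw [divergenceRate, Finset.sum_add_distrib, Finset.sum_ite_mem, Finset.sum_ite_mem,
      Finset.univ_inter, Finset.univ_inter]

end DivergenceRate

section SeparationRate

variable {K l u : ℕ} {I J : Fin K → ℝ} {A A' : Finset (Fin K)}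

theorem divergenceRate_compl : divergenceRate J I Aᶜ A'ᶜ = divergenceRate I J A A' := by
  simp only [divergenceRate, compl_sdiff_compl, add_comm]

theorem divergenceRate_pos (hI : ∀ k, 0 < I k) (hJ : ∀ k, 0 < J k) (h : (A \ A').Nonempty) :
    0 < divergenceRate I J A A' :=
  add_pos_of_pos_of_nonneg (Finset.sum_pos (fun k _ => hI k) h)
    (Finset.sum_nonneg fun k _ => (hJ k).le)

theorem divergenceRate_erase {i : Fin K} (hi : i ∈ A) :
    divergenceRate I J A (A.erase i) = I i := by
  rw [divergenceRate, Finset.sdiff_erase_self hi,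
    Finset.sdiff_eq_empty_iff_subset.2 (A.erase_subset i), Finset.sum_singleton,
    Finset.sum_empty, add_zero]

theorem divergenceRate_insert_erase {i j : Fin K} (hi : i ∈ A) (hj : j ∉ A) :
    divergenceRate I J A (insert j (A.erase i)) = I i + J j := by
  have hsignal : A \ insert j (A.erase i) = {i} := by grind
  have hnoise : insert j (A.erase i) \ A = {j} := by grind
  rw [divergenceRate, hsignal, hnoise, Finset.sum_singleton, Finset.sum_singleton]

theorem minOver_empty (r : Fin K → ℝ) : minOver r ∅ = ⊤ := by
  simp only [minOver, Finset.notMem_empty, iInf_false, iInf_top]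

theorem exists_minOver_eq (r : Fin K → ℝ) {S : Finset (Fin K)} (hS : S.Nonempty) :
    ∃ i ∈ S, minOver r S = .ofReal (r i) := by
  obtain ⟨i, hi, hmin⟩ := S.exists_min_image r hS
  exact ⟨i, hi, le_antisymm (iInf₂_le i hi)
    (le_iInf₂ fun k hk => ENNReal.ofReal_le_ofReal (hmin k hk))⟩

theorem compl_nonempty_of_card_lt (h : A.card < K) : Aᶜ.Nonempty := by
  rwa [← Finset.card_pos, Finset.card_compl, Fintype.card_fin, tsub_pos_iff_lt]

/-- The smallest `divergenceRate` of `A` from a set of size at least `l` that misses a signal of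
`A`: if `A` has more than `l` elements one of them can be dropped, and otherwise it has to be
exchanged for a noise.  The dual notion for noises is obtained by passing to complements. -/
noncomputable def separationRate (I J : Fin K → ℝ) (l : ℕ) (A : Finset (Fin K)) : ℝ≥0∞ :=
  minOver I A + if A.card = l then minOver J Aᶜ else 0

theorem separationRate_empty : separationRate I J l ∅ = ⊤ := by
  rw [separationRate, minOver_empty, top_add]

theorem separationRate_le_of_card_ne (h : A.card ≠ l) {i : Fin K} (hi : i ∈ A) :
    separationRate I J l A ≤ .ofReal (I i) := by
  rw [separationRate, if_neg h, add_zero]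
  exact iInf₂_le i hi

theorem separationRate_le_add (hI : ∀ k, 0 < I k) (hJ : ∀ k, 0 < J k) {i j : Fin K} (hi : i ∈ A)
    (hj : j ∉ A) : separationRate I J l A ≤ .ofReal (I i + J j) := by
  rw [separationRate, ENNReal.ofReal_add (hI i).le (hJ j).le]
  gcongr
  · exact iInf₂_le i hi
  · split_ifs
    · exact iInf₂_le j (Finset.mem_compl.2 hj)
    · exact zero_le

theorem exists_divergenceRate_eq_separationRate (hI : ∀ k, 0 < I k) (hJ : ∀ k, 0 < J k)
    (hl : l < K) (hlA : l ≤ A.card) (hA : A.Nonempty) :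
    ∃ A' : Finset (Fin K), l ≤ A'.card ∧ A'.card ≤ A.card ∧ (A \ A').Nonempty ∧
      .ofReal (divergenceRate I J A A') = separationRate I J l A := by
  obtain ⟨i, hi, hIi⟩ := exists_minOver_eq I hA
  by_cases hcard : A.card = l
  · obtain ⟨j, hj, hJj⟩ := exists_minOver_eq J (compl_nonempty_of_card_lt (hcard ▸ hl))
    rw [Finset.mem_compl] at hj
    have hswap : (insert j (A.erase i)).card = A.card := by
      rw [Finset.card_insert_of_notMem (by grind), Finset.card_erase_add_one hi]
    refine ⟨insert j (A.erase i), hswap ▸ hlA, hswap.le, ⟨i, by grind⟩, ?_⟩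
    rw [divergenceRate_insert_erase hi hj, separationRate, if_pos hcard, hIi, hJj,
      ENNReal.ofReal_add (hI i).le (hJ j).le]
  · refine ⟨A.erase i, ?_, A.card_erase_le, ⟨i, by grind⟩, ?_⟩
    · rw [Finset.card_erase_of_mem hi]
      omega
    · rw [divergenceRate_erase hi, separationRate, if_neg hcard, add_zero, hIi]

theorem separationRate_ne_zero (hI : ∀ k, 0 < I k) : separationRate I J l A ≠ 0 := by
  rcases A.eq_empty_or_nonempty with rfl | hA
  · rw [separationRate_empty]
    exact ENNReal.top_ne_zero
  · obtain ⟨i, -, hIi⟩ := exists_minOver_eq I hA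
    rw [separationRate, hIi]
    exact (add_pos_of_pos_of_nonneg (ENNReal.ofReal_pos.2 (hI i)) zero_le).ne'

theorem separationRate_ne_top (hl : l < K) (hA : A.Nonempty) : separationRate I J l A ≠ ⊤ := by
  obtain ⟨i, -, hIi⟩ := exists_minOver_eq I hA
  refine ENNReal.add_ne_top.2 ⟨hIi ▸ ENNReal.ofReal_ne_top, ?_⟩
  split_ifs with hcard
  · obtain ⟨j, -, hJj⟩ := exists_minOver_eq J (compl_nonempty_of_card_lt (hcard ▸ hl))
    exact hJj ▸ ENNReal.ofReal_ne_top
  · exact ENNReal.zero_ne_top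

theorem card_compl_eq_sub_iff (hu : u ≤ K) : Aᶜ.card = K - u ↔ A.card = u := by
  have := card_finset_fin_le A
  rw [Finset.card_compl, Fintype.card_fin]
  omega

theorem syncRate_eq_max (hu : u ≤ K) (α β : ℝ) :
    syncRate I J l u A α β = max (.ofReal |Real.log α| / separationRate I J l A)
      (.ofReal |Real.log β| / separationRate J I (K - u) Aᶜ) := by
  simp only [syncRate, separationRate, card_compl_eq_sub_iff hu, compl_compl]

end SeparationRate

section LowerBound

variable {K : ℕ} {E : Fin K → Type*} [∀ k, MeasurableSpace (E k)]
  {P₀ P₁ : ∀ k, Measure (ℕ → E k)}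

theorem DecisionRule.IsSynchronous.expectedTime_eq {χ : DecisionRule E} (hχ : χ.IsSynchronous)
    (A : Finset (Fin K)) (j k : Fin K) :
    χ.expectedTime P₀ P₁ A j = χ.expectedTime P₀ P₁ A k := by
  rw [DecisionRule.expectedTime, DecisionRule.expectedTime, hχ j k]

variable [∀ k, IsProbabilityMeasure (P₀ k)] [∀ k, IsProbabilityMeasure (P₁ k)]
  {I J : Fin K → ℝ} {C : Set (Finset (Fin K))} {A A' : Finset (Fin K)} {δ : ℝ}

theorem eventually_le_optimalSyncTime_of_signal
    (hequiv : ∀ k, LocallyEquivalent (P₁ k) (P₀ k)) (hI : ∀ k, 0 < I k) (hJ : ∀ k, 0 < J k)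
    (hsup₁ : ∀ k, LimsupRateLE (P₁ k) (fun n => streamLLR (P₁ k) (P₀ k) n) (I k))
    (hsup₀ : ∀ k, LimsupRateLE (P₀ k) (fun n x => -streamLLR (P₁ k) (P₀ k) n x) (J k))
    (hA : A ∈ C) (hA' : A' ∈ C) (hdiff : (A \ A').Nonempty) (hδ : 0 < δ) (hδ1 : δ < 1)
    (k : Fin K) :
    ∀ᶠ p : ℝ × ℝ in 𝓝[>] 0 ×ˢ 𝓝[>] 0,
      .ofReal (1 - δ) * (.ofReal |Real.log p.1| / .ofReal (divergenceRate I J A A')) ≤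
        optimalSyncTime P₀ P₁ p.1 p.2 C A k := by
  have hR := divergenceRate_pos hI hJ hdiff
  obtain ⟨i, hi⟩ := hdiff
  rw [Finset.mem_sdiff] at hi
  have hL := isLogLikelihoodRatio_jointLLR fun k =>
    locallyEquivalent_streamLaw (A := A) (A' := A') hequiv k
  filter_upwards [hL.eventually_le_lintegral hR
    (ae_growthRateLE_jointLLR hequiv hsup₁ hsup₀ A A') hδ hδ1] with p hp
  refine le_iInf₂ fun χ ⟨hsync, hseq, hctl⟩ => ?_
  rw [hsync.expectedTime_eq A k i, ← ENNReal.ofReal_div_of_pos hR,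
    ← ENNReal.ofReal_mul (sub_pos.2 hδ1).le]
  exact hp (χ.T i) {ω | i ∈ χ.D ω} (hseq i).1 (hseq i).2.1 (fun m hm => ((hseq i).2.2 m hm).1)
    ((hctl A hA).2.2.trans' (measure_mono fun ω hω => ⟨i, hi.1, hω⟩))
    ((hctl A' hA').2.1.trans' (measure_mono fun ω hω => ⟨i, hi.2, hω⟩))

theorem eventually_le_optimalSyncTime_of_noise
    (hequiv : ∀ k, LocallyEquivalent (P₁ k) (P₀ k)) (hI : ∀ k, 0 < I k) (hJ : ∀ k, 0 < J k)
    (hsup₁ : ∀ k, LimsupRateLE (P₁ k) (fun n => streamLLR (P₁ k) (P₀ k) n) (I k))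
    (hsup₀ : ∀ k, LimsupRateLE (P₀ k) (fun n x => -streamLLR (P₁ k) (P₀ k) n x) (J k))
    (hA : A ∈ C) (hA' : A' ∈ C) (hdiff : (A' \ A).Nonempty) (hδ : 0 < δ) (hδ1 : δ < 1)
    (k : Fin K) :
    ∀ᶠ p : ℝ × ℝ in 𝓝[>] 0 ×ˢ 𝓝[>] 0,
      .ofReal (1 - δ) * (.ofReal |Real.log p.2| / .ofReal (divergenceRate I J A A')) ≤
        optimalSyncTime P₀ P₁ p.1 p.2 C A k := by
  have hR : 0 < divergenceRate I J A A' := by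
    rw [← divergenceRate_compl]
    exact divergenceRate_pos hJ hI (by rwa [compl_sdiff_compl])
  obtain ⟨j, hj⟩ := hdiff
  rw [Finset.mem_sdiff] at hj
  have hL := isLogLikelihoodRatio_jointLLR fun k =>
    locallyEquivalent_streamLaw (A := A) (A' := A') hequiv k
  filter_upwards [eventually_swap_iff.1 (hL.eventually_le_lintegral hR
    (ae_growthRateLE_jointLLR hequiv hsup₁ hsup₀ A A') hδ hδ1)] with p hp
  refine le_iInf₂ fun χ ⟨hsync, hseq, hctl⟩ => ?_
  rw [hsync.expectedTime_eq A k j, ← ENNReal.ofReal_div_of_pos hR,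
    ← ENNReal.ofReal_mul (sub_pos.2 hδ1).le]
  exact hp (χ.T j) {ω | j ∉ χ.D ω} (hseq j).1 (hseq j).2.1 (fun m hm => ((hseq j).2.2 m hm).2)
    ((hctl A hA).2.1.trans' (measure_mono fun ω hω => ⟨j, hj.2, not_not.1 hω⟩))
    ((hctl A' hA').2.2.trans' (measure_mono fun ω hω => ⟨j, hj.1, hω⟩))

variable {l u : ℕ}

theorem eventually_mul_syncRate_le_optimalSyncTime
    (hequiv : ∀ k, LocallyEquivalent (P₁ k) (P₀ k)) (hI : ∀ k, 0 < I k) (hJ : ∀ k, 0 < J k)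
    (hsup₁ : ∀ k, LimsupRateLE (P₁ k) (fun n => streamLLR (P₁ k) (P₀ k) n) (I k))
    (hsup₀ : ∀ k, LimsupRateLE (P₀ k) (fun n x => -streamLLR (P₁ k) (P₀ k) n x) (J k))
    (huK : u ≤ K) (hu : 0 < u) (hl : l < K) (hA : A ∈ signalClass K l u) (hδ : 0 < δ)
    (hδ1 : δ < 1) (k : Fin K) :
    ∀ᶠ p : ℝ × ℝ in 𝓝[>] 0 ×ˢ 𝓝[>] 0, .ofReal (1 - δ) * syncRate I J l u A p.1 p.2 ≤
      optimalSyncTime P₀ P₁ p.1 p.2 (signalClass K l u) A k := by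
  have hsignal : ∀ᶠ p : ℝ × ℝ in 𝓝[>] 0 ×ˢ 𝓝[>] 0,
      .ofReal (1 - δ) * (.ofReal |Real.log p.1| / separationRate I J l A) ≤
        optimalSyncTime P₀ P₁ p.1 p.2 (signalClass K l u) A k := by
    rcases A.eq_empty_or_nonempty with rfl | hne
    · simp only [separationRate_empty, ENNReal.div_top, mul_zero, zero_le, eventually_true]
    obtain ⟨A', hlA', hA'A, hdiff, hrate⟩ :=
      exists_divergenceRate_eq_separationRate hI hJ hl hA.1 hne
    rw [← hrate]
    exact eventually_le_optimalSyncTime_of_signal hequiv hI hJ hsup₁ hsup₀ hA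
      ⟨hlA', hA'A.trans hA.2⟩ hdiff hδ hδ1 k
  have hnoise : ∀ᶠ p : ℝ × ℝ in 𝓝[>] 0 ×ˢ 𝓝[>] 0,
      .ofReal (1 - δ) * (.ofReal |Real.log p.2| / separationRate J I (K - u) Aᶜ) ≤
        optimalSyncTime P₀ P₁ p.1 p.2 (signalClass K l u) A k := by
    rcases Aᶜ.eq_empty_or_nonempty with hc | hne
    · simp only [hc, separationRate_empty, ENNReal.div_top, mul_zero, zero_le, eventually_true]
    have hcompl (S : Finset (Fin K)) : Sᶜ.card = K - S.card := by
      rw [Finset.card_compl, Fintype.card_fin]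
    obtain ⟨B, huB, hBA, hdiff, hrate⟩ := exists_divergenceRate_eq_separationRate (l := K - u)
      hJ hI (by omega) (by have := hA.2; rw [hcompl]; omega) hne
    rw [← hrate, ← compl_compl B, divergenceRate_compl]
    refine eventually_le_optimalSyncTime_of_noise hequiv hI hJ hsup₁ hsup₀ hA ⟨?_, ?_⟩
      (by rwa [← compl_sdiff_compl, compl_compl]) hδ hδ1 k
    · have := card_finset_fin_le A
      have := hA.1
      rw [hcompl] at hBA ⊢
      omega
    · rw [hcompl]
      omega
  filter_upwards [hsignal, hnoise] with p hp₁ hp₂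
  rw [syncRate_eq_max huK, mul_max]
  exact max_le hp₁ hp₂

end LowerBound

section StoppingTime

variable {K l u n : ℕ} {A : Finset (Fin K)}

theorem le_orderStat {x : Fin K → ℝ} {p : ℝ} (hp : ∀ i ∈ A, p ≤ x i) :
    (p : EReal) ≤ orderStat x A.card :=
  le_sSup <| Finset.card_le_card fun i hi =>
    Finset.mem_filter.2 ⟨Finset.mem_univ i, EReal.coe_le_coe_iff.2 (hp i hi)⟩

theorem orderStat_le {x : Fin K → ℝ} {q : ℝ} (hq : ∀ j ∉ A, x j ≤ q) :
    orderStat x (A.card + 1) ≤ q := by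
  refine sSup_le fun t ht => ?_
  obtain ⟨k, hk, hkA⟩ := Finset.exists_mem_notMem_of_card_lt_card (Nat.lt_of_succ_le ht)
  exact (Finset.mem_filter.1 hk).2.trans (EReal.coe_le_coe_iff.2 (hq k hkA))

theorem add_orderStat_succ_le {x : Fin K → ℝ} {c : ℝ} (h : ∀ i ∈ A, ∀ j ∉ A, c + x j ≤ x i) :
    c + orderStat x (A.card + 1) ≤ orderStat x A.card := by
  rcases A.eq_empty_or_nonempty with rfl | hA
  · exact le_top.trans (le_sSup (Nat.zero_le _))
  obtain ⟨i, hi, hmin⟩ := A.exists_min_image x hA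
  have hupper : orderStat x (A.card + 1) ≤ (x i - c : ℝ) :=
    orderStat_le fun j hj => le_sub_iff_add_le'.2 (h i hi j hj)
  calc c + orderStat x (A.card + 1) ≤ c + (x i - c : ℝ) := by gcongr
    _ = x i := by rw [← EReal.coe_add, add_sub_cancel]
    _ ≤ orderStat x A.card := le_orderStat hmin

theorem le_orderStat_sub_orderStat_succ {x : Fin K → ℝ} {c : ℝ}
    (h : ∀ i ∈ A, ∀ j ∉ A, c + x j ≤ x i) :
    c ≤ orderStat x A.card - orderStat x (A.card + 1) := by
  obtain ⟨p, hp⟩ := Finite.exists_ge x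
  obtain ⟨q, hq⟩ := Finite.exists_le x
  have hbot : orderStat x A.card ≠ ⊥ :=
    ((EReal.bot_lt_coe p).trans_le (le_orderStat fun i _ => hp i)).ne'
  have htop : orderStat x (A.card + 1) ≠ ⊤ :=
    ((orderStat_le fun j _ => hq j).trans_lt (EReal.coe_lt_top q)).ne
  exact (EReal.le_sub_iff_add_le (.inr hbot) (.inl htop)).2 (add_orderStat_succ_le h)

theorem orderStat_succ_le_neg_add {x : Fin K → ℝ} {c : ℝ} (h : ∀ i ∈ A, ∀ j ∉ A, c + x j ≤ x i) :
    orderStat x (A.card + 1) ≤ -c + orderStat x A.card := by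
  rw [add_comm (-_), ← sub_eq_add_neg, EReal.le_sub_iff_add_le (.inl (EReal.coe_ne_bot c))
    (.inl (EReal.coe_ne_top c)), add_comm _ (c : EReal)]
  exact add_orderStat_succ_le h

theorem numPos_eq_card {x : Fin K → ℝ} (hsignal : ∀ i ∈ A, 0 < x i) (hnoise : ∀ j ∉ A, x j ≤ 0) :
    numPos x = A.card := by
  refine congrArg Finset.card (Finset.ext fun k => ?_)
  rw [Finset.mem_filter_univ]
  exact ⟨fun hk => by_contra fun hkA => hk.not_ge (hnoise k hkA), hsignal k⟩

theorem firstTime_le {P : ℕ → Prop} (hn : 1 ≤ n) (h : P n) : firstTime P ≤ n :=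
  iInf₂_le n ⟨hn, h⟩

theorem syncTime_le_of_separated {a b c d : ℝ} {x : ℕ → Fin K → ℝ} (hA : A ∈ signalClass K l u)
    (ha : 0 < a) (hb : 0 ≤ b) (hn : 1 ≤ n)
    (hsignal : A.card ≠ l → ∀ i ∈ A, a ≤ x n i) (hnoise : A.card ≠ u → ∀ j ∉ A, x n j ≤ -b)
    (hgap_l : A.card = l → ∀ i ∈ A, ∀ j ∉ A, c + x n j ≤ x n i)
    (hgap_u : A.card = u → ∀ i ∈ A, ∀ j ∉ A, d + x n j ≤ x n i) :
    syncTime l u a b c d x ≤ n := by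
  rw [syncTime]
  split_ifs with hlu
  · obtain rfl : A.card = l := le_antisymm (hA.2.trans_eq hlu.symm) hA.1
    refine firstTime_le hn (le_orderStat_sub_orderStat_succ fun i hi j hj => ?_)
    rw [max_add]
    exact max_le (hgap_l rfl i hi j hj) (hgap_u hlu i hi j hj)
  by_cases hl : A.card = l
  · have hnoise := hnoise fun hu => hlu (hl.symm.trans hu)
    refine min_le_of_left_le (firstTime_le hn (le_min ?_ ?_))
    · rw [← hl, ← EReal.coe_neg]
      exact orderStat_le hnoise
    · rw [← hl]
      exact orderStat_succ_le_neg_add (hgap_l hl)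
  by_cases hu : A.card = u
  · refine min_le_of_right_le (min_le_of_right_le (firstTime_le hn (max_le ?_ ?_)))
    · rw [← hu]
      exact le_orderStat (hsignal hl)
    · rw [← hu]
      exact add_orderStat_succ_le (hgap_u hu)
  · refine min_le_of_right_le (min_le_of_left_le (firstTime_le hn ⟨fun k hk => ?_, ?_⟩))
    · by_cases hkA : k ∈ A
      · exact hk.2.not_ge (hsignal hl k hkA)
      · exact hk.1.not_ge (hnoise hu k hkA)
    · rw [numPos_eq_card (fun i hi => ha.trans_le (hsignal hl i hi))
        fun j hj => (hnoise hu j hj).trans (neg_nonpos.2 hb)]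
      exact hA

theorem le_mul_of_div_separationRate_le {I J : Fin K → ℝ} {r s y : ℝ} (hr : 0 < r) (hs : 0 ≤ s)
    (hrate : separationRate I J l A ≤ .ofReal r)
    (h : .ofReal y / separationRate I J l A ≤ .ofReal s) : y ≤ s * r := by
  rw [← div_le_iff₀ hr, ← ENNReal.ofReal_le_ofReal_iff hs, ENNReal.ofReal_div_of_pos hr]
  exact (ENNReal.div_le_div_left hrate _).trans h

theorem syncTime_le_of_growth {I J : Fin K → ℝ} (hI : ∀ k, 0 < I k) (hJ : ∀ k, 0 < J k)
    (huK : u ≤ K) (hA : A ∈ signalClass K l u) {a b c d s y z : ℝ} {x : ℕ → Fin K → ℝ}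
    (ha : 0 < a) (hb : 0 ≤ b) (hn : 1 ≤ n) (hs : 0 ≤ s)
    (hay : a ≤ y) (hbz : b ≤ z) (hcy : c ≤ y) (hdz : d ≤ z)
    (hy : .ofReal y / separationRate I J l A ≤ .ofReal s)
    (hz : .ofReal z / separationRate J I (K - u) Aᶜ ≤ .ofReal s)
    (hsignal : ∀ i ∈ A, s * I i ≤ x n i) (hnoise : ∀ j ∉ A, s * J j ≤ -x n j) :
    syncTime l u a b c d x ≤ n := by
  refine syncTime_le_of_separated hA ha hb hn (fun hl i hi => ?_) (fun hu j hj => ?_)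
    (fun _ i hi j hj => ?_) fun _ i hi j hj => ?_
  · exact (hay.trans (le_mul_of_div_separationRate_le (hI i) hs
      (separationRate_le_of_card_ne hl hi) hy)).trans (hsignal i hi)
  · have hz := le_mul_of_div_separationRate_le (hJ j) hs (separationRate_le_of_card_ne
      ((card_compl_eq_sub_iff huK).not.2 hu) (Finset.mem_compl.2 hj)) hz
    linarith [hnoise j hj]
  · have hy := le_mul_of_div_separationRate_le (add_pos (hI i) (hJ j)) hs
      (separationRate_le_add hI hJ hi hj) hy
    linarith [hsignal i hi, hnoise j hj]
  · have hz := le_mul_of_div_separationRate_le (add_pos (hJ j) (hI i)) hs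
      (separationRate_le_add hJ hI (Finset.mem_compl.2 hj) (Finset.notMem_compl.2 hi)) hz
    linarith [hsignal i hi, hnoise j hj]

end StoppingTime

section ExpectedTime

theorem encard_setOf_natCast_lt (t : ℕ∞) : {n : ℕ | (n : ℕ∞) < t}.encard = t := by
  cases t with
  | top => simp only [ENat.natCast_lt_top, Set.ofPred_true, Set.encard_univ,
      ENat.card_eq_top_of_infinite]
  | coe m =>
    have h : {n : ℕ | (n : ℕ∞) < m} = Finset.range m := by ext n; simp
    rw [h, Set.encard_coe_eq_coe_finsetCard, Finset.card_range]

theorem lintegral_time_le {Ω : Type*} {m₀ : MeasurableSpace Ω} {μ : Measure Ω}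
    [IsProbabilityMeasure μ] {T : Ω → ℕ∞} {bad : ℕ → Set Ω}
    (hbad : ∀ n, MeasurableSet (bad n)) {N : ℕ} (h : ∀ n, N ≤ n → ∀ ω ∉ bad n, T ω ≤ n) :
    ∫⁻ ω, (T ω : ℝ≥0∞) ∂μ ≤ N + ∑' n, μ (bad n) := by
  have hpoint (ω : Ω) : (T ω : ℝ≥0∞) ≤ N + ∑' n, (bad n).indicator 1 ω := by
    have hsub : {n : ℕ | (n : ℕ∞) < T ω} ⊆ Set.Iio N ∪ {n | ω ∈ bad n} := fun n hn =>
      (lt_or_ge n N).imp id fun hN => by_contra fun hω => hn.not_ge (h n hN ω hω)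
    calc (T ω : ℝ≥0∞) = ({n : ℕ | (n : ℕ∞) < T ω}.encard : ℝ≥0∞) := by
          rw [encard_setOf_natCast_lt]
      _ ≤ ((Set.Iio N).encard + {n | ω ∈ bad n}.encard : ℕ∞) :=
          ENat.toENNReal_le.2 ((Set.encard_le_encard hsub).trans (Set.encard_union_le _ _))
      _ = N + ∑' n, (bad n).indicator 1 ω := by
          have hIio : (Set.Iio N).encard = N := by
            rw [← Finset.coe_Iio, Set.encard_coe_eq_coe_finsetCard, Nat.card_Iio]
          rw [ENat.toENNReal_add, hIio, ENat.toENNReal_coe, ← ENNReal.tsum_set_one,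
            tsum_subtype {n | ω ∈ bad n} fun _ => (1 : ℝ≥0∞)]
          rfl
  calc ∫⁻ ω, (T ω : ℝ≥0∞) ∂μ ≤ ∫⁻ ω, N + ∑' n, (bad n).indicator 1 ω ∂μ := lintegral_mono hpoint
    _ = N + ∑' n, μ (bad n) := by
      rw [lintegral_add_left measurable_const, lintegral_const, measure_univ, mul_one,
        lintegral_tsum fun n => (measurable_one.indicator (hbad n)).aemeasurable]
      simp_rw [lintegral_indicator_one (hbad _)]

theorem CompleteLowerRate.tsum_measure_le_lt_top {E : Type*} [MeasurableSpace E]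
    {μ : Measure (ℕ → E)} [IsFiniteMeasure μ] {ξ : ℕ → (ℕ → E) → ℝ} {r ε : ℝ}
    (h : CompleteLowerRate μ ξ r) (hr : 0 < r) (hε : 0 < ε) :
    ∑' n : ℕ, μ {x | ξ n x ≤ (1 - ε) * n * r} < ⊤ := by
  rw [tsum_eq_zero_add' ENNReal.summable]
  refine ENNReal.add_lt_top.2 ⟨measure_lt_top μ _, ?_⟩
  convert h (ε * r) (mul_pos hε hr) using 6 with n x
  rw [div_le_iff₀ (by positivity)]
  ring_nf

variable {K l u : ℕ} {E : Fin K → Type*} [∀ k, MeasurableSpace (E k)]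

/-- The log-likelihood ratio of stream `k` in favour of its true status when `A` is the set of
signals. -/
noncomputable def supportingLLR (P₀ P₁ : ∀ k, Measure (ℕ → E k)) (A : Finset (Fin K))
    (k : Fin K) (n : ℕ) (x : ℕ → E k) : ℝ :=
  if k ∈ A then streamLLR (P₁ k) (P₀ k) n x else -streamLLR (P₁ k) (P₀ k) n x

/-- The asymptotic growth rate of `supportingLLR`. -/
noncomputable def supportingRate (I J : Fin K → ℝ) (A : Finset (Fin K)) (k : Fin K) : ℝ :=
  if k ∈ A then I k else J k

/-- The event that at time `n` the evidence in some stream has grown at most at `1 - ε` times its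
asymptotic rate. -/
def slowGrowth (P₀ P₁ : ∀ k, Measure (ℕ → E k)) (I J : Fin K → ℝ) (A : Finset (Fin K)) (ε : ℝ)
    (n : ℕ) : Set (Obs E) :=
  {ω | ∃ k, supportingLLR P₀ P₁ A k n (ω k) ≤ (1 - ε) * n * supportingRate I J A k}

variable {P₀ P₁ : ∀ k, Measure (ℕ → E k)} {I J : Fin K → ℝ} {A : Finset (Fin K)} {ε : ℝ}

theorem measurable_supportingLLR (k : Fin K) (n : ℕ) : Measurable (supportingLLR P₀ P₁ A k n) := by
  have h := (measurable_streamLLR (P₁ k) (P₀ k) n).mono (streamSigma_le n) le_rfl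
  unfold supportingLLR
  split_ifs
  exacts [h, h.neg]

theorem slowGrowth_eq_iUnion (n : ℕ) : slowGrowth P₀ P₁ I J A ε n =
    ⋃ k, Function.eval k ⁻¹' {x | supportingLLR P₀ P₁ A k n x ≤
      (1 - ε) * n * supportingRate I J A k} :=
  Set.ofPred_exists _

theorem measurableSet_slowGrowth (n : ℕ) : MeasurableSet (slowGrowth P₀ P₁ I J A ε n) := by
  rw [slowGrowth_eq_iUnion]
  exact .iUnion fun k => measurable_pi_apply k (measurable_supportingLLR k n measurableSet_Iic)

theorem completeLowerRate_supportingLLR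
    (hcc₁ : ∀ k, CompleteLowerRate (P₁ k) (fun n => streamLLR (P₁ k) (P₀ k) n) (I k))
    (hcc₀ : ∀ k, CompleteLowerRate (P₀ k) (fun n x => -streamLLR (P₁ k) (P₀ k) n x) (J k))
    (k : Fin K) : CompleteLowerRate (streamLaw P₀ P₁ A k) (supportingLLR P₀ P₁ A k)
      (supportingRate I J A k) := by
  unfold streamLaw supportingLLR supportingRate
  split_ifs
  exacts [hcc₁ k, hcc₀ k]

variable [∀ k, IsProbabilityMeasure (P₀ k)] [∀ k, IsProbabilityMeasure (P₁ k)]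

theorem tsum_slowGrowth_lt_top (hI : ∀ k, 0 < I k) (hJ : ∀ k, 0 < J k)
    (hcc₁ : ∀ k, CompleteLowerRate (P₁ k) (fun n => streamLLR (P₁ k) (P₀ k) n) (I k))
    (hcc₀ : ∀ k, CompleteLowerRate (P₀ k) (fun n x => -streamLLR (P₁ k) (P₀ k) n x) (J k))
    (hε : 0 < ε) : ∑' n, jointLaw P₀ P₁ A (slowGrowth P₀ P₁ I J A ε n) < ⊤ := by
  have hrate (k : Fin K) : 0 < supportingRate I J A k := by
    unfold supportingRate
    split_ifs
    exacts [hI k, hJ k]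
  calc ∑' n, jointLaw P₀ P₁ A (slowGrowth P₀ P₁ I J A ε n)
      ≤ ∑' n : ℕ, ∑ k, streamLaw P₀ P₁ A k {x | supportingLLR P₀ P₁ A k n x ≤
          (1 - ε) * n * supportingRate I J A k} := ENNReal.tsum_le_tsum fun n => by
        rw [slowGrowth_eq_iUnion, jointLaw_eq_pi_streamLaw]
        refine (measure_iUnion_fintype_le _ _).trans_eq (Finset.sum_congr rfl fun k _ => ?_)
        exact (measurePreserving_eval _ k).measure_preimage
          (measurable_supportingLLR k n measurableSet_Iic).nullMeasurableSet
    _ = ∑ k, ∑' n : ℕ, streamLaw P₀ P₁ A k {x | supportingLLR P₀ P₁ A k n x ≤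
          (1 - ε) * n * supportingRate I J A k} :=
        Summable.tsum_finsetSum fun _ _ => ENNReal.summable
    _ < ⊤ := ENNReal.sum_lt_top.2 fun k _ =>
        (completeLowerRate_supportingLLR hcc₁ hcc₀ k).tsum_measure_le_lt_top (hrate k) hε

theorem expectedTime_syncTest_le (hI : ∀ k, 0 < I k) (hJ : ∀ k, 0 < J k) (huK : u ≤ K)
    (hA : A ∈ signalClass K l u) (hε : ε ≤ 1) {a b c d y z : ℝ} (ha : 0 < a) (hb : 0 ≤ b)
    (hay : a ≤ y) (hbz : b ≤ z) (hcy : c ≤ y) (hdz : d ≤ z) {N : ℕ} (hN : 1 ≤ N)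
    (hy : .ofReal y / separationRate I J l A ≤ .ofReal ((1 - ε) * N))
    (hz : .ofReal z / separationRate J I (K - u) Aᶜ ≤ .ofReal ((1 - ε) * N)) (k : Fin K) :
    (syncTest P₀ P₁ l u a b c d).expectedTime P₀ P₁ A k ≤
      N + ∑' n, jointLaw P₀ P₁ A (slowGrowth P₀ P₁ I J A ε n) := by
  refine lintegral_time_le measurableSet_slowGrowth fun n hn ω hω => ?_
  have hgrowth (k : Fin K) :
      (1 - ε) * n * supportingRate I J A k ≤ supportingLLR P₀ P₁ A k n (ω k) :=
    (not_le.1 fun h => hω ⟨k, h⟩).le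
  have hNn : ENNReal.ofReal ((1 - ε) * N) ≤ .ofReal ((1 - ε) * n) :=
    ENNReal.ofReal_le_ofReal
      (mul_le_mul_of_nonneg_left (Nat.cast_le.2 hn) (sub_nonneg.2 hε))
  refine syncTime_le_of_growth hI hJ huK hA ha hb (hN.trans hn)
    (mul_nonneg (sub_nonneg.2 hε) n.cast_nonneg) hay hbz hcy hdz (hy.trans hNn) (hz.trans hNn)
    (fun i hi => ?_) fun j hj => ?_
  · simpa only [supportingRate, supportingLLR, obsLLR, if_pos hi] using hgrowth i
  · simpa only [supportingRate, supportingLLR, obsLLR, if_neg hj] using hgrowth j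

theorem syncRate_ne_top (hI : ∀ k, 0 < I k) (hJ : ∀ k, 0 < J k) (huK : u ≤ K) (α β : ℝ) :
    syncRate I J l u A α β ≠ ⊤ := by
  rw [syncRate_eq_max huK]
  exact (max_lt (ENNReal.div_lt_top ENNReal.ofReal_ne_top (separationRate_ne_zero hI))
    (ENNReal.div_lt_top ENNReal.ofReal_ne_top (separationRate_ne_zero hJ))).ne

theorem exists_expectedTime_syncTest_le_mul_syncRate_add (hI : ∀ k, 0 < I k) (hJ : ∀ k, 0 < J k)
    (hcc₁ : ∀ k, CompleteLowerRate (P₁ k) (fun n => streamLLR (P₁ k) (P₀ k) n) (I k))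
    (hcc₀ : ∀ k, CompleteLowerRate (P₀ k) (fun n x => -streamLLR (P₁ k) (P₀ k) n x) (J k))
    (huK : u ≤ K) (hA : A ∈ signalClass K l u) (hε : 0 < ε) (hε1 : ε < 1) {t : ℝ} (ht : 0 ≤ t) :
    ∃ B : ℝ≥0∞, B ≠ ⊤ ∧ ∀ a b c d α β : ℝ, 0 < a → 0 ≤ b →
      a ≤ t * |Real.log α| → b ≤ t * |Real.log β| → c ≤ t * |Real.log α| →
      d ≤ t * |Real.log β| → ∀ k, (syncTest P₀ P₁ l u a b c d).expectedTime P₀ P₁ A k ≤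
        .ofReal (t / (1 - ε)) * syncRate I J l u A α β + B := by
  refine ⟨2 + ∑' n, jointLaw P₀ P₁ A (slowGrowth P₀ P₁ I J A ε n), ENNReal.add_ne_top.2
    ⟨by simp, (tsum_slowGrowth_lt_top hI hJ hcc₁ hcc₀ hε).ne⟩, ?_⟩
  intro a b c d α β ha hb hay hbz hcy hdz k
  have hε' : 0 < 1 - ε := sub_pos.2 hε1
  set v : ℝ := (syncRate I J l u A α β).toReal
  have hv : ENNReal.ofReal v = syncRate I J l u A α β :=
    ENNReal.ofReal_toReal (syncRate_ne_top hI hJ huK α β)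
  have hv0 : 0 ≤ t / (1 - ε) * v := by positivity
  set N : ℕ := ⌈t / (1 - ε) * v⌉₊ + 1
  have hNv : t * v ≤ (1 - ε) * N := by
    rw [← div_le_iff₀' hε', ← div_mul_eq_mul_div]
    exact (Nat.le_ceil _).trans (Nat.cast_le.2 (Nat.le_succ _))
  have hscale {y : ℝ} {r : ℝ≥0∞} (h : .ofReal y / r ≤ syncRate I J l u A α β) :
      .ofReal (t * y) / r ≤ .ofReal ((1 - ε) * N) := by
    rw [ENNReal.ofReal_mul ht, mul_div_assoc]
    refine le_trans ?_ (ENNReal.ofReal_le_ofReal hNv)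
    rw [ENNReal.ofReal_mul ht, hv]
    gcongr
  rw [syncRate_eq_max huK] at hscale
  calc (syncTest P₀ P₁ l u a b c d).expectedTime P₀ P₁ A k
      ≤ N + ∑' n, jointLaw P₀ P₁ A (slowGrowth P₀ P₁ I J A ε n) :=
        expectedTime_syncTest_le hI hJ huK hA hε1.le ha hb hay hbz hcy hdz (Nat.le_add_left _ _)
          (hscale (le_max_left _ _)) (hscale (le_max_right _ _)) k
    _ ≤ _ := by
      rw [← add_assoc, ← hv, ← ENNReal.ofReal_mul (by positivity)]
      gcongr
      calc (N : ℝ≥0∞) = .ofReal N := (ENNReal.ofReal_natCast N).symm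
        _ ≤ .ofReal (t / (1 - ε) * v + 2) := by
          gcongr
          simp only [N, Nat.cast_add, Nat.cast_one]
          linarith [Nat.ceil_lt_add_one hv0]
        _ = .ofReal (t / (1 - ε) * v) + 2 := by
          rw [ENNReal.ofReal_add hv0 zero_le_two, ENNReal.ofReal_ofNat]

end ExpectedTime

section Asymptotics

theorem tendsto_div_nhds_one_of_bounds {ι : Type*} {L : Filter ι} {f s : ι → ℝ≥0∞}
    (hs0 : ∀ᶠ p in L, s p ≠ 0) (hs : ∀ᶠ p in L, s p ≠ ⊤)
    (hlower : ∀ δ : ℝ, 0 < δ → δ < 1 → ∀ᶠ p in L, .ofReal (1 - δ) * s p ≤ f p)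
    (hupper : ∀ δ : ℝ, 0 < δ → ∀ᶠ p in L, f p ≤ .ofReal (1 + δ) * s p) :
    Tendsto (fun p => f p / s p) L (𝓝 1) := by
  refine (ENNReal.tendsto_nhds ENNReal.one_ne_top).2 fun ε hε => ?_
  obtain ⟨δ, -, hδ, hδε⟩ := ENNReal.lt_iff_exists_real_btwn.1 (lt_min hε one_pos)
  have hδ0 : 0 < δ := ENNReal.ofReal_pos.1 hδ
  have hδ1 : δ < 1 := ENNReal.ofReal_lt_one.1 (hδε.trans_le (min_le_right _ _))
  have hδε' : ENNReal.ofReal δ ≤ ε := hδε.le.trans (min_le_left _ _)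
  filter_upwards [hs0, hs, hlower δ hδ0 hδ1, hupper δ hδ0] with p hp0 hp hfl hfu
  rw [Set.mem_Icc, ENNReal.le_div_iff_mul_le (.inl hp0) (.inl hp),
    ENNReal.div_le_iff hp0 hp]
  rw [ENNReal.ofReal_sub _ hδ0.le, ENNReal.ofReal_one] at hfl
  rw [ENNReal.ofReal_add zero_le_one hδ0.le, ENNReal.ofReal_one] at hfu
  exact ⟨le_trans (by gcongr) hfl, hfu.trans (by gcongr)⟩

theorem AsympEquiv.trans_symm {f g s : ℝ → ℝ → ℝ≥0∞} (hf : AsympEquiv f s) (hg : AsympEquiv g s)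
    (hs0 : ∀ᶠ p : ℝ × ℝ in 𝓝[>] 0 ×ˢ 𝓝[>] 0, s p.1 p.2 ≠ 0)
    (hs : ∀ᶠ p : ℝ × ℝ in 𝓝[>] 0 ×ˢ 𝓝[>] 0, s p.1 p.2 ≠ ⊤) : AsympEquiv f g := by
  have h := ENNReal.Tendsto.div hf (.inl one_ne_zero) hg (.inl ENNReal.one_ne_top)
  rw [div_one] at h
  refine h.congr' ?_
  filter_upwards [hs0, hs] with p hp0 hp
  rw [div_eq_mul_inv (f _ _), div_eq_mul_inv (g _ _),
    ENNReal.mul_div_mul_right _ _ (ENNReal.inv_ne_zero.2 hp) (ENNReal.inv_ne_top.2 hp0)]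

theorem asympEquiv_of_sandwich {f g s : ℝ → ℝ → ℝ≥0∞}
    (hs0 : ∀ᶠ p : ℝ × ℝ in 𝓝[>] 0 ×ˢ 𝓝[>] 0, s p.1 p.2 ≠ 0)
    (hs : ∀ᶠ p : ℝ × ℝ in 𝓝[>] 0 ×ˢ 𝓝[>] 0, s p.1 p.2 ≠ ⊤)
    (hlower : ∀ δ : ℝ, 0 < δ → δ < 1 → ∀ᶠ p : ℝ × ℝ in 𝓝[>] 0 ×ˢ 𝓝[>] 0,
      .ofReal (1 - δ) * s p.1 p.2 ≤ g p.1 p.2)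
    (hgf : ∀ᶠ p : ℝ × ℝ in 𝓝[>] 0 ×ˢ 𝓝[>] 0, g p.1 p.2 ≤ f p.1 p.2)
    (hupper : ∀ δ : ℝ, 0 < δ → ∀ᶠ p : ℝ × ℝ in 𝓝[>] 0 ×ˢ 𝓝[>] 0,
      f p.1 p.2 ≤ .ofReal (1 + δ) * s p.1 p.2) :
    AsympEquiv f g ∧ AsympEquiv g s := by
  have hf : AsympEquiv f s := tendsto_div_nhds_one_of_bounds hs0 hs
    (fun δ hδ hδ1 => ((hlower δ hδ hδ1).and hgf).mono fun _ h => h.1.trans h.2) hupper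
  have hg : AsympEquiv g s := tendsto_div_nhds_one_of_bounds hs0 hs hlower fun δ hδ =>
    (hgf.and (hupper δ hδ)).mono fun _ h => h.1.trans h.2
  exact ⟨hf.trans_symm hg hs0 hs, hg⟩

theorem ThresholdEquiv.eventually_le {h : ℝ → ℝ → ℝ} {γ : ℝ × ℝ → ℝ} (hh : ThresholdEquiv h γ)
    (hγ : Tendsto γ (𝓝[>] 0 ×ˢ 𝓝[>] 0) (𝓝[>] 0)) {ε : ℝ} (hε : 0 < ε) :
    ∀ᶠ p in 𝓝[>] 0 ×ˢ 𝓝[>] 0, h p.1 p.2 ≤ (1 + ε) * |Real.log (γ p)| := by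
  filter_upwards [hh.eventually_lt_const (lt_add_of_pos_right 1 hε),
    (tendsto_abs_log_nhdsGT_zero.comp hγ).eventually_gt_atTop 0] with p hp hp0
  exact ((div_lt_iff₀ hp0).1 hp).le

theorem tendsto_ofReal_abs_log_div {r : ℝ≥0∞} (hr : r ≠ ⊤) :
    Tendsto (fun γ => .ofReal |Real.log γ| / r) (𝓝[>] 0) (𝓝 ⊤) := by
  have h := ENNReal.Tendsto.div_const (ENNReal.tendsto_ofReal_nhds_top.2
    tendsto_abs_log_nhdsGT_zero) (.inl ENNReal.top_ne_zero) (b := r)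
  rwa [ENNReal.top_div_of_ne_top hr] at h

variable {K l u : ℕ} {I J : Fin K → ℝ} {A : Finset (Fin K)}

theorem tendsto_syncRate (hl : l < K) (huK : u ≤ K) (hu : 0 < u) :
    Tendsto (fun p : ℝ × ℝ => syncRate I J l u A p.1 p.2) (𝓝[>] 0 ×ˢ 𝓝[>] 0) (𝓝 ⊤) := by
  simp only [syncRate_eq_max huK]
  rcases A.eq_empty_or_nonempty with rfl | hA
  · have hne : separationRate J I (K - u) (∅ : Finset (Fin K))ᶜ ≠ ⊤ :=
      separationRate_ne_top (by omega) (compl_nonempty_of_card_lt (by simpa using hu.trans_le huK))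
    exact tendsto_of_tendsto_of_tendsto_of_le_of_le
      ((tendsto_ofReal_abs_log_div hne).comp tendsto_snd) tendsto_const_nhds
      (fun _ => le_max_right _ _) fun _ => le_top
  · exact tendsto_of_tendsto_of_tendsto_of_le_of_le
      ((tendsto_ofReal_abs_log_div (separationRate_ne_top hl hA)).comp tendsto_fst)
      tendsto_const_nhds (fun _ => le_max_left _ _) fun _ => le_top

variable {E : Fin K → Type*} [∀ k, MeasurableSpace (E k)] {P₀ P₁ : ∀ k, Measure (ℕ → E k)}

theorem optimalSyncTime_le_expectedTime_syncTest {a b c d α β : ℝ} {𝓐 : Set (Finset (Fin K))}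
    (h : syncTest P₀ P₁ l u a b c d ∈ ControlledTests P₀ P₁ α β 𝓐) (k : Fin K) :
    optimalSyncTime P₀ P₁ α β 𝓐 A k ≤
      (syncTest P₀ P₁ l u a b c d).expectedTime P₀ P₁ A k :=
  iInf₂_le _ ⟨fun _ _ => rfl, h⟩

variable [∀ k, IsProbabilityMeasure (P₀ k)] [∀ k, IsProbabilityMeasure (P₁ k)]

theorem eventually_expectedTime_syncTest_le (hI : ∀ k, 0 < I k) (hJ : ∀ k, 0 < J k)
    (hcc₁ : ∀ k, CompleteLowerRate (P₁ k) (fun n => streamLLR (P₁ k) (P₀ k) n) (I k))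
    (hcc₀ : ∀ k, CompleteLowerRate (P₀ k) (fun n x => -streamLLR (P₁ k) (P₀ k) n x) (J k))
    (huK : u ≤ K) (hu : 0 < u) (hl : l < K) (hA : A ∈ signalClass K l u) {a b c d : ℝ → ℝ → ℝ}
    (ha0 : ∀ᶠ p : ℝ × ℝ in 𝓝[>] 0 ×ˢ 𝓝[>] 0, 0 < a p.1 p.2)
    (hb0 : ∀ᶠ p : ℝ × ℝ in 𝓝[>] 0 ×ˢ 𝓝[>] 0, 0 < b p.1 p.2)
    (ha : ThresholdEquiv a Prod.fst) (hc : ThresholdEquiv c Prod.fst)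
    (hb : ThresholdEquiv b Prod.snd) (hd : ThresholdEquiv d Prod.snd)
    {δ : ℝ} (hδ : 0 < δ) (k : Fin K) :
    ∀ᶠ p : ℝ × ℝ in 𝓝[>] 0 ×ˢ 𝓝[>] 0,
      (syncTest P₀ P₁ l u (a p.1 p.2) (b p.1 p.2) (c p.1 p.2) (d p.1 p.2)).expectedTime
        P₀ P₁ A k ≤ .ofReal (1 + δ) * syncRate I J l u A p.1 p.2 := by
  -- The solution of `(1 + ε) / (1 - ε) = 1 + δ / 2`.
  set ε : ℝ := δ / (4 + δ) with hε
  have hε0 : 0 < ε := by positivity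
  have hε1 : ε < 1 := (div_lt_one (by positivity)).2 (by linarith)
  have hratio : (1 + ε) / (1 - ε) = 1 + δ / 2 := by
    rw [div_eq_iff (sub_pos.2 hε1).ne', hε]
    field_simp
    ring
  obtain ⟨B, hB, hle⟩ := exists_expectedTime_syncTest_le_mul_syncRate_add hI hJ hcc₁ hcc₀ huK hA
    hε0 hε1 (t := 1 + ε) (by positivity)
  have hBrate : ∀ᶠ p : ℝ × ℝ in 𝓝[>] 0 ×ˢ 𝓝[>] 0,
      B ≤ .ofReal (δ / 2) * syncRate I J l u A p.1 p.2 := by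
    have h := ENNReal.Tendsto.const_mul (a := .ofReal (δ / 2))
      (tendsto_syncRate (I := I) (J := J) (A := A) hl huK hu) (.inl ENNReal.top_ne_zero)
    rw [ENNReal.mul_top (ENNReal.ofReal_pos.2 (half_pos hδ)).ne'] at h
    exact h.eventually_const_le hB.lt_top
  filter_upwards [ha0, hb0, ha.eventually_le tendsto_fst hε0, hb.eventually_le tendsto_snd hε0,
    hc.eventually_le tendsto_fst hε0, hd.eventually_le tendsto_snd hε0, hBrate]
    with p ha0 hb0 ha hb hc hd hB
  refine (hle _ _ _ _ _ _ ha0 hb0.le ha hb hc hd k).trans ?_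
  calc _ ≤ .ofReal (1 + δ / 2) * syncRate I J l u A p.1 p.2 +
        .ofReal (δ / 2) * syncRate I J l u A p.1 p.2 := by rw [hratio]; gcongr
    _ = .ofReal (1 + δ) * syncRate I J l u A p.1 p.2 := by
        rw [← add_mul, ← ENNReal.ofReal_add (by positivity) (by positivity), add_assoc,
          add_halves]

end Asymptotics

end SeqMT

theorem theorem4p3 {K : ℕ} {E : Fin K → Type*} [∀ k, MeasurableSpace (E k)]
    (P₀ P₁ : ∀ k, Measure (ℕ → E k))
    [∀ k, IsProbabilityMeasure (P₀ k)] [∀ k, IsProbabilityMeasure (P₁ k)]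
    (hequiv : ∀ k, LocallyEquivalent (P₁ k) (P₀ k))
    (I J : Fin K → ℝ) (hI : ∀ k, 0 < I k) (hJ : ∀ k, 0 < J k)
    (hsup₁ : ∀ k, LimsupRateLE (P₁ k) (fun n => streamLLR (P₁ k) (P₀ k) n) (I k))
    (hsup₀ : ∀ k, LimsupRateLE (P₀ k) (fun n x => -streamLLR (P₁ k) (P₀ k) n x) (J k))
    (hcc₁ : ∀ k, CompleteLowerRate (P₁ k) (fun n => streamLLR (P₁ k) (P₀ k) n) (I k))
    (hcc₀ : ∀ k, CompleteLowerRate (P₀ k) (fun n x => -streamLLR (P₁ k) (P₀ k) n x) (J k))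
    (l u : ℕ) (hlu : l ≤ u) (huK : u ≤ K) (hu : 0 < u) (hl : l < K)
    (a b c d : ℝ → ℝ → ℝ)
    (hpos : ∀ α ∈ Set.Ioo (0 : ℝ) 1, ∀ β ∈ Set.Ioo (0 : ℝ) 1,
      0 < a α β ∧ 0 < b α β ∧ 0 < c α β ∧ 0 < d α β)
    (hcontrol : ∀ α ∈ Set.Ioo (0 : ℝ) 1, ∀ β ∈ Set.Ioo (0 : ℝ) 1,
      syncTest P₀ P₁ l u (a α β) (b α β) (c α β) (d α β) ∈
        ControlledTests P₀ P₁ α β (signalClass K l u))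
    (ha : ThresholdEquiv a Prod.fst) (hc : ThresholdEquiv c Prod.fst)
    (hb : ThresholdEquiv b Prod.snd) (hd : ThresholdEquiv d Prod.snd) :
    ∀ A ∈ signalClass K l u,
      AsympEquiv
        (fun α β => (syncTest P₀ P₁ l u (a α β) (b α β) (c α β) (d α β)).expectedTime
          P₀ P₁ A ⟨0, Nat.zero_lt_of_lt hl⟩)
        (fun α β => optimalSyncTime P₀ P₁ α β (signalClass K l u) A ⟨0, Nat.zero_lt_of_lt hl⟩) ∧
      AsympEquiv
        (fun α β => optimalSyncTime P₀ P₁ α β (signalClass K l u) A ⟨0, Nat.zero_lt_of_lt hl⟩)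
        (fun α β => syncRate I J l u A α β) := by
  intro A hA
  have hunit : ∀ᶠ p : ℝ × ℝ in 𝓝[>] 0 ×ˢ 𝓝[>] 0, p.1 ∈ Set.Ioo 0 1 ∧ p.2 ∈ Set.Ioo 0 1 :=
    prod_mem_prod (Ioo_mem_nhdsGT one_pos) (Ioo_mem_nhdsGT one_pos)
  refine asympEquiv_of_sandwich ?rate_ne_zero ?rate_ne_top ?lower ?optimal ?upper
  case rate_ne_zero => exact (tendsto_syncRate hl huK hu).eventually_ne ENNReal.top_ne_zero
  case rate_ne_top => exact .of_forall fun p => syncRate_ne_top hI hJ huK p.1 p.2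
  case lower =>
    intro δ hδ hδ1
    exact eventually_mul_syncRate_le_optimalSyncTime hequiv hI hJ hsup₁ hsup₀ huK hu hl hA hδ hδ1 _
  case optimal =>
    exact hunit.mono fun p hp =>
      optimalSyncTime_le_expectedTime_syncTest (hcontrol _ hp.1 _ hp.2) _
  case upper =>
    intro δ hδ
    exact eventually_expectedTime_syncTest_le hI hJ hcc₁ hcc₀ huK hu hl hA
      (hunit.mono fun p hp => (hpos _ hp.1 _ hp.2).1)
      (hunit.mono fun p hp => (hpos _ hp.1 _ hp.2).2.1) ha hc hb hd hδ _
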